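/- Let $K$ be a number field with ring of integers $R$. Let $p$ be a prime number, let $q=p^m$ with $m\geq 1$, and let $n\geq 1$. Assume that $K$ contains a primitive $p$-th root of unity. Then there exists a twist $J$ for the group algebra $K\,\mathrm{PSL}_{2n+1}(q)$, arising from a $2$-cocycle on an abelian subgroup, such that the Hopf algebra $(K\,\mathrm{PSL}_{2n+1}(q))_J$ does not admit a Hopf order over $R$. Here, for a Hopf algebra $H$ over $K$ with coproduct $\Delta$, counit $\varepsilon$ and antipode $S$: - A twist for $H$ is an invertible element $J=\sum J^{(1)}\otimes J^{(2)}\in H\otimes H$ with $(1\otimes J)(\mathrm{id}\otimes\Delta)(J)=(J\otimes 1)(\Delta\otimes\mathrm{id})(J)$ and $(\varepsilon\otimes\mathrm{id})(J)=(\mathrm{id}\otimes\varepsilon)(J)=1$. The Hopf algebra $H_J$ is $H$ as an algebra, with the counit of $H$, coproduct $\Delta_J(h)=J\Delta(h)J^{-1}$ and antipode $S_J(h)=U_JS(h)U_J^{-1}$, where $U_J=\sum J^{(1)}S(J^{(2)})$. - A twist $J$ for the group algebra $KG$ of a finite group $G$ arises from a $2$-cocycle on an abelian subgroup if there are an abelian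 subgroup $M$ of $G$ such that $KM$ is isomorphic as an algebra to a product of copies of $K$, and a normalized $2$-cocycle $\omega:\widehat M\times\widehat M\to K^\times$ on the character group $\widehat M=\mathrm{Hom}(M,K^\times)$ (with trivial action on $K^\times$), such that $J=\sum_{\phi,\psi\in\widehat M}\omega(\phi,\psi)\,e_\phi\otimes e_\psi$, where $e_\phi=\frac1{|M|}\sum_{m\in M}\phi(m^{-1})m$. - A Hopf order of $H$ over $R$ is a finitely generated projective $R$-submodule $X$ of $H$ such that the natural map $X\otimes_R K\to H$ is an isomorphism and $1\in X$, $XX\subseteq X$, $\Delta(X)\subseteq X\otimes_R X$ (viewed inside $H\otimes_K H$), $\varepsilon(X)\subseteq R$ and $S(X)\subseteq X$. -/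

import Mathlib

open scoped TensorProduct

noncomputable section

section HopfOrder

/-- The submodule `X ⊗_R X` of `H ⊗_K H`: the image of the natural map, that is, the `R`-span of
the pure tensors `x ⊗ y` with `x, y ∈ X`. -/
def tensorSquare (K : Type*) [Field K] {H : Type*} [Ring H] [HopfAlgebra K H]
    {R : Type*} [CommRing R] [Algebra R K] [Module R H] [IsScalarTower R K H]
    (X : Submodule R H) : Submodule R (H ⊗[K] H) :=
  Submodule.span R {z | ∃ x ∈ X, ∃ y ∈ X, z = x ⊗ₜ[K] y}

/-- A Hopf order over `R` of a Hopf algebra `H` over `K`: a lattice `X` of `H` over `R` (a finitely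
generated projective `R`-submodule such that `K ⊗_R X → H` is an isomorphism) which is closed
under the Hopf algebra operations. -/
structure IsHopfOrder (K : Type*) [Field K] {H : Type*} [Ring H] [HopfAlgebra K H]
    {R : Type*} [CommRing R] [Algebra R K] [Module R H] [IsScalarTower R K H]
    (X : Submodule R H) : Prop where
  finite : Module.Finite R X
  projective : Module.Projective R X
  isBaseChange : IsBaseChange K X.subtype
  one_mem : (1 : H) ∈ X
  mul_mem : ∀ x ∈ X, ∀ y ∈ X, x * y ∈ X
  comul_mem : ∀ x ∈ X, Coalgebra.comul (R := K) x ∈ tensorSquare K X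
  counit_mem : ∀ x ∈ X, ∃ r : R, algebraMap R K r = Coalgebra.counit (R := K) x
  antipode_mem : ∀ x ∈ X, HopfAlgebra.antipode K x ∈ X

end HopfOrder

/-- A twist for the Hopf algebra `H`: an invertible `J ∈ H ⊗ H` such that
`(1 ⊗ J) (id ⊗ Δ)(J) = (J ⊗ 1) (Δ ⊗ id)(J)` and `(ε ⊗ id)(J) = (id ⊗ ε)(J) = 1`. -/
structure DrinfeldTwist (K : Type*) [Field K] (H : Type*) [Ring H] [HopfAlgebra K H] where
  /-- the underlying invertible element of `H ⊗ H` -/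
  elt : (H ⊗[K] H)ˣ
  cocycle :
    ((1 : H) ⊗ₜ[K] (elt : H ⊗[K] H)) *
        (Coalgebra.comul (R := K) (A := H)).lTensor H (elt : H ⊗[K] H) =
      TensorProduct.assoc K H H H (((elt : H ⊗[K] H) ⊗ₜ[K] (1 : H)) *
        (Coalgebra.comul (R := K) (A := H)).rTensor H (elt : H ⊗[K] H))
  counit_left :
    TensorProduct.lid K H
      ((Coalgebra.counit (R := K) (A := H)).rTensor H (elt : H ⊗[K] H)) = 1
  counit_right :
    TensorProduct.rid K H
      ((Coalgebra.counit (R := K) (A := H)).lTensor H (elt : H ⊗[K] H)) = 1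

namespace DrinfeldTwist

variable {K : Type*} [Field K] {H : Type*} [Ring H] [HopfAlgebra K H] (J : DrinfeldTwist K H)

open Coalgebra Bialgebra HopfAlgebra

/-- The twisted coproduct `Δ_J(h) = J Δ(h) J⁻¹`, as an algebra homomorphism. -/
def comulHom : H →ₐ[K] H ⊗[K] H :=
  AlgHom.ofLinearMap
    (LinearMap.mulLeft K (J.elt : H ⊗[K] H) ∘ₗ
      LinearMap.mulRight K (↑J.elt⁻¹ : H ⊗[K] H) ∘ₗ comul)
    (by simp)
    (fun x y => by simp [mul_assoc])

theorem comulHom_apply (h : H) :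
    J.comulHom h = (J.elt : H ⊗[K] H) * comul h * (↑J.elt⁻¹ : H ⊗[K] H) := by
  simp [comulHom, mul_assoc]

/-- `Δ ⊗ id` -/
abbrev dl : H ⊗[K] H →ₐ[K] (H ⊗[K] H) ⊗[K] H :=
  Algebra.TensorProduct.map (comulAlgHom K H) (AlgHom.id K H)

/-- `id ⊗ Δ` -/
abbrev dr : H ⊗[K] H →ₐ[K] H ⊗[K] (H ⊗[K] H) :=
  Algebra.TensorProduct.map (AlgHom.id K H) (comulAlgHom K H)

/-- the associator -/
abbrev tassoc : (H ⊗[K] H) ⊗[K] H ≃ₐ[K] H ⊗[K] (H ⊗[K] H) :=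
  Algebra.TensorProduct.assoc K K K H H H

theorem map_left (x : H ⊗[K] H) :
    Algebra.TensorProduct.map J.comulHom (AlgHom.id K H) x =
      ((J.elt : H ⊗[K] H) ⊗ₜ[K] (1 : H)) * dl x * ((↑J.elt⁻¹ : H ⊗[K] H) ⊗ₜ[K] (1 : H)) := by
  induction x using TensorProduct.induction_on with
  | zero => simp
  | tmul a b => simp [comulHom_apply]
  | add a b ha hb => simp only [map_add, ha, hb, mul_add, add_mul]

theorem map_right (x : H ⊗[K] H) :
    Algebra.TensorProduct.map (AlgHom.id K H) J.comulHom x =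
      ((1 : H) ⊗ₜ[K] (J.elt : H ⊗[K] H)) * dr x * ((1 : H) ⊗ₜ[K] (↑J.elt⁻¹ : H ⊗[K] H)) := by
  induction x using TensorProduct.induction_on with
  | zero => simp
  | tmul a b => simp [comulHom_apply]
  | add a b ha hb => simp only [map_add, ha, hb, mul_add, add_mul]

theorem cocycle' :
    ((1 : H) ⊗ₜ[K] (J.elt : H ⊗[K] H)) * dr (J.elt : H ⊗[K] H) =
      tassoc (((J.elt : H ⊗[K] H) ⊗ₜ[K] (1 : H)) * dl (J.elt : H ⊗[K] H)) :=
  J.cocycle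

theorem cocycle_inv :
    dr (↑J.elt⁻¹ : H ⊗[K] H) * ((1 : H) ⊗ₜ[K] (↑J.elt⁻¹ : H ⊗[K] H)) =
      tassoc (dl (↑J.elt⁻¹ : H ⊗[K] H) * ((↑J.elt⁻¹ : H ⊗[K] H) ⊗ₜ[K] (1 : H))) := by
  refine left_inv_eq_right_inv
    (a := ((1 : H) ⊗ₜ[K] (J.elt : H ⊗[K] H)) * dr (J.elt : H ⊗[K] H)) ?_ ?_
  · rw [mul_assoc, ← mul_assoc (_ ⊗ₜ _) (_ ⊗ₜ _), Algebra.TensorProduct.tmul_mul_tmul, one_mul,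
      Units.inv_mul, ← Algebra.TensorProduct.one_def, one_mul, ← map_mul, Units.inv_mul, map_one]
  · rw [cocycle', ← map_mul, mul_assoc, ← mul_assoc (dl _) (dl _), ← map_mul, Units.mul_inv,
      map_one, one_mul, Algebra.TensorProduct.tmul_mul_tmul, one_mul, Units.mul_inv,
      ← Algebra.TensorProduct.one_def, map_one]

theorem counit_left' :
    Algebra.TensorProduct.lid K H
      (Algebra.TensorProduct.map (counitAlgHom K H) (AlgHom.id K H) (J.elt : H ⊗[K] H)) = 1 :=
  J.counit_left

theorem counit_right' :
    Algebra.TensorProduct.rid K K H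
      (Algebra.TensorProduct.map (AlgHom.id K H) (counitAlgHom K H) (J.elt : H ⊗[K] H)) = 1 :=
  J.counit_right

theorem counit_left_inv :
    Algebra.TensorProduct.lid K H
      (Algebra.TensorProduct.map (counitAlgHom K H) (AlgHom.id K H)
        (↑J.elt⁻¹ : H ⊗[K] H)) = 1 := by
  have := congrArg (fun z => Algebra.TensorProduct.lid K H
      (Algebra.TensorProduct.map (counitAlgHom K H) (AlgHom.id K H) z)) J.elt.mul_inv
  simpa only [map_mul, counit_left', one_mul, map_one] using this

theorem counit_right_inv :
    Algebra.TensorProduct.rid K K H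
      (Algebra.TensorProduct.map (AlgHom.id K H) (counitAlgHom K H)
        (↑J.elt⁻¹ : H ⊗[K] H)) = 1 := by
  have := congrArg (fun z => Algebra.TensorProduct.rid K K H
      (Algebra.TensorProduct.map (AlgHom.id K H) (counitAlgHom K H) z)) J.elt.mul_inv
  simpa only [map_mul, counit_right', one_mul, map_one] using this

theorem coassoc_aux (h : H) :
    tassoc (dl (comul (R := K) h)) = dr (comul (R := K) h) :=
  Coalgebra.coassoc_apply h

/-- The bialgebra with the multiplication and counit of `H` and the coproduct `Δ_J`. -/
abbrev bialgebra : Bialgebra K H :=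
  Bialgebra.ofAlgHom J.comulHom (counitAlgHom K H)
    (by
      apply AlgHom.ext
      intro h
      change tassoc (Algebra.TensorProduct.map J.comulHom (AlgHom.id K H) (J.comulHom h)) =
        Algebra.TensorProduct.map (AlgHom.id K H) J.comulHom (J.comulHom h)
      rw [map_left, map_right, comulHom_apply]
      simp only [map_mul]
      have h1 := J.cocycle'
      have h2 := J.cocycle_inv
      simp only [map_mul] at h1 h2
      have h3 := coassoc_aux (K := K) h
      rw [← mul_assoc, ← mul_assoc, ← h1, h3, mul_assoc _ (tassoc (dl _)), ← h2]
      simp only [mul_assoc])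
    (by
      apply AlgHom.ext
      intro h
      apply (Algebra.TensorProduct.lid K H).injective
      have h3 : Algebra.TensorProduct.lid K H (Algebra.TensorProduct.map (counitAlgHom K H)
          (AlgHom.id K H) (comul (R := K) h)) = h := by
        have := Coalgebra.rTensor_counit_comul (R := K) h
        change Algebra.TensorProduct.lid K H (counit.rTensor H (comul (R := K) h)) = h
        rw [this]; simp
      simp [comulHom_apply, counit_left', counit_left_inv, h3])
    (by
      apply AlgHom.ext
      intro h
      apply (Algebra.TensorProduct.rid K K H).injective
      have h3 : Algebra.TensorProduct.rid K K H (Algebra.TensorProduct.map (AlgHom.id K H)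
          (counitAlgHom K H) (comul (R := K) h)) = h := by
        have := Coalgebra.lTensor_counit_comul (R := K) h
        change Algebra.TensorProduct.rid K K H (counit.lTensor H (comul (R := K) h)) = h
        rw [this]; simp
      simp [comulHom_apply, counit_right', counit_right_inv, h3])

/-- `m (id ⊗ S)` -/
abbrev mS : H ⊗[K] H →ₗ[K] H := LinearMap.mul' K H ∘ₗ (antipode K).lTensor H

/-- `m (S ⊗ id)` -/
abbrev Sm : H ⊗[K] H →ₗ[K] H := LinearMap.mul' K H ∘ₗ (antipode K).rTensor H

/-- `a ⊗ b ⊗ c ↦ a S(b) c` -/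
abbrev F : H ⊗[K] (H ⊗[K] H) →ₗ[K] H := LinearMap.mul' K H ∘ₗ Sm.lTensor H

/-- `a ⊗ b ⊗ c ↦ S(a) b S(c)` -/
abbrev F' : H ⊗[K] (H ⊗[K] H) →ₗ[K] H :=
  LinearMap.mul' K H ∘ₗ TensorProduct.map (antipode K) mS

theorem F_lhs (x y : H ⊗[K] H) :
    F (((1 : H) ⊗ₜ[K] y) * tassoc (x ⊗ₜ[K] (1 : H))) = mS x * Sm y := by
  induction x using TensorProduct.induction_on with
  | zero => simp
  | add a b ha hb => simp only [map_add, TensorProduct.add_tmul, mul_add, ha, hb, add_mul]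
  | tmul a b =>
    induction y using TensorProduct.induction_on with
    | zero => simp
    | add c d hc hd => simp only [map_add, TensorProduct.tmul_add, mul_add, hc, hd, add_mul]
    | tmul c d => simp [antipode_mul_antidistrib, mul_assoc]

theorem F_rhs_aux (a d : H) (z w : H ⊗[K] H) :
    F ((a ⊗ₜ[K] z) * tassoc (w ⊗ₜ[K] d)) = a * mS w * Sm z * d := by
  induction z using TensorProduct.induction_on with
  | zero => simp
  | add x y hx hy => simp only [map_add, TensorProduct.tmul_add, mul_add, hx, hy, add_mul]
  | tmul x y =>
    induction w using TensorProduct.induction_on with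
    | zero => simp
    | add s t hs ht =>
      simp only [map_add, TensorProduct.add_tmul, mul_add, hs, ht, add_mul]
    | tmul s t => simp [antipode_mul_antidistrib, mul_assoc]

theorem F_rhs (x y : H ⊗[K] H) :
    F (dr x * tassoc (dl y)) =
      Algebra.TensorProduct.rid K K H
          (Algebra.TensorProduct.map (AlgHom.id K H) (counitAlgHom K H) x) *
        Algebra.TensorProduct.lid K H
          (Algebra.TensorProduct.map (counitAlgHom K H) (AlgHom.id K H) y) := by
  induction x using TensorProduct.induction_on with
  | zero => simp
  | add a b ha hb => simp only [map_add, ha, hb, add_mul]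
  | tmul a b =>
    induction y using TensorProduct.induction_on with
    | zero => simp
    | add c d hc hd => simp only [map_add, mul_add, hc, hd]
    | tmul c d =>
      have := F_rhs_aux a d (comul (R := K) b) (comul (R := K) c)
      simp only [Algebra.TensorProduct.map_tmul, AlgHom.coe_id, id_eq, comulAlgHom_apply,
        counitAlgHom_apply, Algebra.TensorProduct.rid_tmul, Algebra.TensorProduct.lid_tmul] at *
      rw [this]
      simp [Algebra.algebraMap_eq_smul_one, smul_smul, mul_comm]

theorem F'_lhs (x y : H ⊗[K] H) :
    F' (tassoc (y ⊗ₜ[K] (1 : H)) * ((1 : H) ⊗ₜ[K] x)) = Sm y * mS x := by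
  induction x using TensorProduct.induction_on with
  | zero => simp
  | add a b ha hb => simp only [map_add, TensorProduct.tmul_add, mul_add, ha, hb]
  | tmul a b =>
    induction y using TensorProduct.induction_on with
    | zero => simp
    | add c d hc hd => simp only [map_add, TensorProduct.add_tmul, hc, hd, add_mul]
    | tmul c d => simp [mul_assoc]

theorem F'_rhs_aux (b c : H) (z w : H ⊗[K] H) :
    F' (tassoc (z ⊗ₜ[K] b) * (c ⊗ₜ[K] w)) = antipode K c * Sm z * mS w * antipode K b := by
  induction z using TensorProduct.induction_on with
  | zero => simp
  | add x y hx hy => simp only [map_add, TensorProduct.add_tmul, mul_add, hx, hy, add_mul]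
  | tmul x y =>
    induction w using TensorProduct.induction_on with
    | zero => simp
    | add s t hs ht =>
      simp only [map_add, TensorProduct.tmul_add, mul_add, hs, ht, add_mul]
    | tmul s t => simp [antipode_mul_antidistrib, mul_assoc]

theorem F'_rhs (x y : H ⊗[K] H) :
    F' (tassoc (dl x) * dr y) =
      antipode K (Algebra.TensorProduct.rid K K H
          (Algebra.TensorProduct.map (AlgHom.id K H) (counitAlgHom K H) y)) *
        antipode K (Algebra.TensorProduct.lid K H
          (Algebra.TensorProduct.map (counitAlgHom K H) (AlgHom.id K H) x)) := by
  induction x using TensorProduct.induction_on with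
  | zero => simp
  | add a b ha hb => simp only [map_add, ha, hb, mul_add, add_mul]
  | tmul a b =>
    induction y using TensorProduct.induction_on with
    | zero => simp
    | add c d hc hd => simp only [map_add, mul_add, hc, hd, add_mul]
    | tmul c d =>
      have := F'_rhs_aux b c (comul (R := K) a) (comul (R := K) d)
      simp only [Algebra.TensorProduct.map_tmul, AlgHom.coe_id, id_eq, comulAlgHom_apply,
        counitAlgHom_apply, Algebra.TensorProduct.rid_tmul, Algebra.TensorProduct.lid_tmul] at *
      rw [this]
      simp [Algebra.algebraMap_eq_smul_one, smul_smul, mul_comm]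

theorem mS_mul_Sm : mS (J.elt : H ⊗[K] H) * Sm (↑J.elt⁻¹ : H ⊗[K] H) = 1 := by
  rw [← F_lhs]
  have key : ((1 : H) ⊗ₜ[K] (↑J.elt⁻¹ : H ⊗[K] H)) * tassoc ((J.elt : H ⊗[K] H) ⊗ₜ[K] (1 : H)) =
      dr (J.elt : H ⊗[K] H) * tassoc (dl (↑J.elt⁻¹ : H ⊗[K] H)) := by
    have h1 := J.cocycle'
    rw [map_mul] at h1
    calc _ = ((1 : H) ⊗ₜ[K] (↑J.elt⁻¹ : H ⊗[K] H)) *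
          (tassoc ((J.elt : H ⊗[K] H) ⊗ₜ[K] (1 : H)) * tassoc (dl (J.elt : H ⊗[K] H))) *
            tassoc (dl (↑J.elt⁻¹ : H ⊗[K] H)) := by
          rw [mul_assoc, mul_assoc, ← map_mul tassoc (dl _), ← map_mul dl, Units.mul_inv, map_one,
            map_one, mul_one]
      _ = _ := by
          rw [← h1, ← mul_assoc (_ ⊗ₜ _) (_ ⊗ₜ _), Algebra.TensorProduct.tmul_mul_tmul,
            Units.inv_mul, one_mul, ← Algebra.TensorProduct.one_def, one_mul]
  rw [key, F_rhs, counit_right', counit_left_inv, one_mul]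

theorem Sm_mul_mS : Sm (↑J.elt⁻¹ : H ⊗[K] H) * mS (J.elt : H ⊗[K] H) = 1 := by
  rw [← F'_lhs]
  have key : tassoc ((↑J.elt⁻¹ : H ⊗[K] H) ⊗ₜ[K] (1 : H)) * ((1 : H) ⊗ₜ[K] (J.elt : H ⊗[K] H)) =
      tassoc (dl (J.elt : H ⊗[K] H)) * dr (↑J.elt⁻¹ : H ⊗[K] H) := by
    have h1 := J.cocycle'
    rw [map_mul] at h1
    calc _ = tassoc ((↑J.elt⁻¹ : H ⊗[K] H) ⊗ₜ[K] (1 : H)) *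
          (((1 : H) ⊗ₜ[K] (J.elt : H ⊗[K] H)) * dr (J.elt : H ⊗[K] H)) *
            dr (↑J.elt⁻¹ : H ⊗[K] H) := by
          rw [mul_assoc, mul_assoc, ← map_mul dr, Units.mul_inv, map_one, mul_one]
      _ = _ := by
          rw [h1, ← mul_assoc (tassoc _) (tassoc _), ← map_mul tassoc, Algebra.TensorProduct.tmul_mul_tmul,
            Units.inv_mul, one_mul, ← Algebra.TensorProduct.one_def, map_one, one_mul]
  rw [key, F'_rhs, counit_left', counit_right_inv, antipode_one, one_mul]

/-- The invertible element `U_J = ∑ J⁽¹⁾ S(J⁽²⁾)`, with inverse `∑ S(J⁻⁽¹⁾) J⁻⁽²⁾`. -/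
def U : Hˣ where
  val := LinearMap.mul' K H ((antipode K).lTensor H (J.elt : H ⊗[K] H))
  inv := LinearMap.mul' K H ((antipode K).rTensor H (↑J.elt⁻¹ : H ⊗[K] H))
  val_inv := J.mS_mul_Sm
  inv_val := J.Sm_mul_mS

/-- The twisted antipode `S_J(h) = U_J S(h) U_J⁻¹`. -/
def antipodeMap : H →ₗ[K] H :=
  LinearMap.mulLeft K (J.U : H) ∘ₗ LinearMap.mulRight K (↑J.U⁻¹ : H) ∘ₗ antipode K

theorem antipodeMap_apply (h : H) :
    J.antipodeMap h = (J.U : H) * antipode K h * (↑J.U⁻¹ : H) := by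
  simp [antipodeMap, mul_assoc]

theorem Sm_mul_tmul (w : H ⊗[K] H) (a b : H) :
    Sm (w * (a ⊗ₜ[K] b)) = antipode K a * Sm w * b := by
  induction w using TensorProduct.induction_on with
  | zero => simp
  | add x y hx hy => simp only [map_add, mul_add, hx, hy, add_mul]
  | tmul x y => simp [antipode_mul_antidistrib, mul_assoc]

theorem tmul_mul_mS (w : H ⊗[K] H) (a b : H) :
    mS ((a ⊗ₜ[K] b) * w) = a * mS w * antipode K b := by
  induction w using TensorProduct.induction_on with
  | zero => simp
  | add x y hx hy => simp only [map_add, mul_add, hx, hy, add_mul]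
  | tmul x y => simp [antipode_mul_antidistrib, mul_assoc]

theorem left_aux₁ (x : H ⊗[K] H) (c d e f : H) :
    LinearMap.mul' K H (J.antipodeMap.rTensor H (x * (c ⊗ₜ[K] d) * (e ⊗ₜ[K] f))) =
      (J.U : H) * antipode K e * antipode K c * Sm ((↑J.elt⁻¹ : H ⊗[K] H) * x) * d * f := by
  induction x using TensorProduct.induction_on with
  | zero => simp
  | add x y hx hy => simp only [map_add, mul_add, hx, hy, add_mul]
  | tmul x y =>
    rw [Sm_mul_tmul]
    change _ = _ * (_ * (↑J.U⁻¹ : H) * _) * _ * _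
    simp [antipodeMap_apply, antipode_mul_antidistrib, mul_assoc]

theorem left_aux₂ (z : H ⊗[K] H) (e f : H) :
    LinearMap.mul' K H (J.antipodeMap.rTensor H ((J.elt : H ⊗[K] H) * z * (e ⊗ₜ[K] f))) =
      (J.U : H) * antipode K e * Sm z * f := by
  induction z using TensorProduct.induction_on with
  | zero => simp
  | add x y hx hy => simp only [map_add, mul_add, hx, hy, add_mul]
  | tmul x y =>
    rw [left_aux₁, Units.inv_mul]
    simp [Algebra.TensorProduct.one_def, mul_assoc]

theorem left_aux₃ (h : H) (y : H ⊗[K] H) :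
    LinearMap.mul' K H (J.antipodeMap.rTensor H ((J.elt : H ⊗[K] H) * comul h * y)) =
      counit (R := K) h • ((J.U : H) * Sm y) := by
  induction y using TensorProduct.induction_on with
  | zero => simp
  | add x y hx hy => simp only [map_add, mul_add, hx, hy, smul_add]
  | tmul x y =>
    rw [left_aux₂]
    simp [Algebra.algebraMap_eq_smul_one, mul_assoc]

theorem right_aux₁ (x : H ⊗[K] H) (c d e f : H) :
    LinearMap.mul' K H (J.antipodeMap.lTensor H ((e ⊗ₜ[K] f) * (c ⊗ₜ[K] d) * x)) =
      e * c * mS (x * (J.elt : H ⊗[K] H)) * antipode K d * antipode K f * (↑J.U⁻¹ : H) := by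
  induction x using TensorProduct.induction_on with
  | zero => simp
  | add x y hx hy => simp only [map_add, mul_add, hx, hy, add_mul]
  | tmul x y =>
    rw [tmul_mul_mS]
    change _ = _ * (_ * (J.U : H) * _) * _ * _ * _
    simp [antipodeMap_apply, antipode_mul_antidistrib, mul_assoc]

theorem right_aux₂ (z : H ⊗[K] H) (e f : H) :
    LinearMap.mul' K H (J.antipodeMap.lTensor H ((e ⊗ₜ[K] f) * z * (↑J.elt⁻¹ : H ⊗[K] H))) =
      e * mS z * antipode K f * (↑J.U⁻¹ : H) := by
  induction z using TensorProduct.induction_on with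
  | zero => simp
  | add x y hx hy => simp only [map_add, mul_add, hx, hy, add_mul]
  | tmul x y =>
    rw [right_aux₁, Units.inv_mul]
    simp [Algebra.TensorProduct.one_def, mul_assoc]

theorem right_aux₃ (h : H) (y : H ⊗[K] H) :
    LinearMap.mul' K H (J.antipodeMap.lTensor H (y * comul h * (↑J.elt⁻¹ : H ⊗[K] H))) =
      counit (R := K) h • (mS y * (↑J.U⁻¹ : H)) := by
  induction y using TensorProduct.induction_on with
  | zero => simp
  | add x y hx hy => simp only [map_add, hx, hy, smul_add, add_mul]
  | tmul x y =>
    rw [right_aux₂]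
    simp [Algebra.algebraMap_eq_smul_one, mul_assoc]

/-- The Drinfeld twist of `H` by `J`, as a second Hopf algebra structure on the algebra `H`. -/
abbrev hopfAlgebra : HopfAlgebra K H :=
  { J.bialgebra with
    antipode := J.antipodeMap
    mul_antipode_rTensor_comul := by
      apply LinearMap.ext
      intro h
      change LinearMap.mul' K H (J.antipodeMap.rTensor H (J.comulHom h)) =
        algebraMap K H (counit h)
      rw [comulHom_apply, left_aux₃]
      change _ • ((J.U : H) * (↑J.U⁻¹ : H)) = _
      rw [Units.mul_inv, Algebra.algebraMap_eq_smul_one]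
    mul_antipode_lTensor_comul := by
      apply LinearMap.ext
      intro h
      change LinearMap.mul' K H (J.antipodeMap.lTensor H (J.comulHom h)) =
        algebraMap K H (counit h)
      rw [comulHom_apply, right_aux₃]
      change _ • ((J.U : H) * (↑J.U⁻¹ : H)) = _
      rw [Units.mul_inv, Algebra.algebraMap_eq_smul_one] }

/-- The underlying algebra of the Drinfeld twist `H_J`: a copy of `H`, which carries the Hopf
algebra structure with coproduct `Δ_J`, the counit of `H`, and antipode `S_J`. -/
@[nolint unusedArguments]
def Twisted (_J : DrinfeldTwist K H) : Type _ := H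

instance : Ring J.Twisted := inferInstanceAs (Ring H)

instance : HopfAlgebra K J.Twisted := J.hopfAlgebra

theorem twisted_smul (k : K) (h : H) :
    (k • (show J.Twisted from h) : J.Twisted) = (show J.Twisted from k • h) :=
  rfl

theorem twisted_comul (h : H) :
    Coalgebra.comul (R := K) (A := J.Twisted) h =
      (J.elt : H ⊗[K] H) * Coalgebra.comul (R := K) h * (↑J.elt⁻¹ : H ⊗[K] H) :=
  J.comulHom_apply h

theorem twisted_counit (h : H) :
    Coalgebra.counit (R := K) (A := J.Twisted) h = Coalgebra.counit (R := K) h :=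
  rfl

theorem twisted_antipode (h : H) :
    HopfAlgebra.antipode K (A := J.Twisted) h =
      (J.U : H) * HopfAlgebra.antipode K h * (↑J.U⁻¹ : H) :=
  J.antipodeMap_apply h

end DrinfeldTwist

section Movshev

/-- A normalized 2-cocycle on the group `A` with values in `Kˣ`, with trivial action. -/
structure IsNormalizedTwoCocycle {K : Type*} [Field K] {A : Type*} [Group A]
    (ω : A → A → Kˣ) : Prop where
  cocycle : ∀ φ ψ χ, ω φ ψ * ω (φ * ψ) χ = ω ψ χ * ω φ (ψ * χ)
  one_left : ∀ φ, ω 1 φ = 1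
  one_right : ∀ φ, ω φ 1 = 1

/-- The group algebra `K M` splits: it is isomorphic, as an algebra, to a product of copies
of `K`. -/
def GroupAlgebraSplits (K : Type*) [Field K] (M : Type*) [Group M] : Prop :=
  ∃ k : ℕ, Nonempty (MonoidAlgebra K M ≃ₐ[K] (Fin k → K))

/-- The element `e_φ = (1 / |M|) ∑_{m ∈ M} φ(m⁻¹) m` of `K G` for a character `φ` of the
subgroup `M` of the finite group `G`. -/
def charIdempotent {K : Type*} [Field K] {G : Type*} [Group G] [Finite G]
    {M : Subgroup G} (φ : M →* Kˣ) : MonoidAlgebra K G :=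
  ((Nat.card M : ℕ) : K)⁻¹ •
    ∑ᶠ m : M, MonoidAlgebra.single (m : G) ((φ m⁻¹ : Kˣ) : K)

/-- The element `J_{M, ω} = ∑_{φ, ψ} ω(φ, ψ) e_φ ⊗ e_ψ`, where `φ` and `ψ` run through the (finite)
group of characters of `M` with values in `Kˣ`. -/
def cocycleElement {K : Type*} [Field K] {G : Type*} [Group G] [Finite G]
    {M : Subgroup G} (ω : (M →* Kˣ) → (M →* Kˣ) → Kˣ) :
    MonoidAlgebra K G ⊗[K] MonoidAlgebra K G :=
  ∑ᶠ (φ : M →* Kˣ) (ψ : M →* Kˣ),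
    ((ω φ ψ : Kˣ) : K) • (charIdempotent φ ⊗ₜ[K] charIdempotent ψ)

/-- The twist `J` of `K G` arises from a 2-cocycle on an abelian subgroup: there is an abelian
subgroup `M` of `G`, such that `K M` splits and the order of `M` is invertible in `K`, and a
normalized 2-cocycle `ω` on the character group of `M` such that `J = J_{M, ω}`. -/
def DrinfeldTwist.ArisesFromAbelianSubgroup {K : Type*} [Field K] {G : Type*} [Group G] [Finite G]
    (J : DrinfeldTwist K (MonoidAlgebra K G)) : Prop :=
  ∃ M : Subgroup G, (∀ a ∈ M, ∀ b ∈ M, a * b = b * a) ∧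
    ((Nat.card M : ℕ) : K) ≠ 0 ∧ GroupAlgebraSplits K M ∧
    ∃ ω : (M →* Kˣ) → (M →* Kˣ) → Kˣ, IsNormalizedTwoCocycle ω ∧
      (J.elt : MonoidAlgebra K G ⊗[K] MonoidAlgebra K G) = cocycleElement ω

end Movshev

end

/-!
The twist comes from an elementary abelian subgroup `M` of order `p²`, made of transvections in a
copy of `SL₃(𝔽_p)` (modulo scalars) inside `PSL_{2n+1}(F)`, and from a nondegenerate bicharacter on
its character group. A Hopf order `X` of the twisted algebra is refuted by an integrality argument.

Functionals which are integral on `X` are closed under convolution, so they act by integral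
matrices on every comodule; since a lattice is reflexive, the trace of the matrix of a comodule lies
in `X` (`IsHopfOrder.trace_comatrix_mem`). For a group element `h`, the twisted coalgebra has a
comodule of dimension `|M|` with trace `c = |M| e₀ h e₀`, where `e₀` is the idempotent of the trivial
character of `M` (`IsIndicatorFamily.card_sq_smul_mem`); the dimension is this small because the
twisted group algebra of the dual of `M` is a matrix algebra.

Let `χ` be a permutation character of a subgroup `L` containing `M`, `g` and `h`. The elements of
`X ∩ K L` have integral traces, so `χ(c ·)` is integral on `X ∩ K L`, and it extends to an integral
functional on `K G`, because `X ∩ K L` is a direct summand of `X`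
(`exists_isIntegralOn_extension`). Contracting the twisted coproduct of `e₀ g e₀` with it gives back
`e₀ g e₀`, multiplied by `t = |M| χ(e₀ h e₀ g) = |M|⁻¹ ∑ χ(m h m' g)`. Hence `t` preserves a nonzero
finitely generated module and is integral (`IsIndicatorFamily.card_sq_mul_trace_mem`), which means
that `|M|` divides `∑ χ(m h m' g)` (`card_sq_dvd_sum_card_fixedBy`).

Let `L` be the image of `SL₃(k)`, `k = 𝔽_p`, acting on the projective space of `k³ × k³`. Fixed points
are lines of pairs of eigenvectors, so modulo `|k|²` only those eigenvalues `c` matter for which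
`m h m' g - c` is invertible. For suitable `g` and `h` the determinant of `m h m' g - c` is an
affine form in `m`, which vanishes identically for one `m'` and is nonconstant for all others. The
resulting count is not divisible by `|M| = |k|²` (`not_card_sq_dvd_sum_card_fixedBy`).
-/

open scoped LinearAlgebra.Projectivization

noncomputable section

/-! ### Integrality of traces -/

theorem Submodule.isIntegral_of_fg_of_mul_mem {R A : Type*} [CommRing R] [Ring A] [Algebra R A]
    {S : Submodule R A} (hfg : S.FG) (hone : (1 : A) ∈ S) (hmul : ∀ x ∈ S, ∀ y ∈ S, x * y ∈ S)
    {x : A} (hx : x ∈ S) : IsIntegral R x := by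
  refine IsIntegral.of_mem_of_fg (S.toSubalgebra hone fun x y hx hy => hmul x hx y hy) ?_ x hx
  simpa using hfg

/-- The eigenvalues of an integral matrix are integral, hence so is their sum. -/
theorem Matrix.isIntegral_trace {R K ι : Type*} [CommRing R] [Field K] [Algebra R K]
    [Fintype ι] [DecidableEq ι] {A : Matrix ι ι K} (hA : IsIntegral R A) :
    IsIntegral R A.trace := by
  let L := AlgebraicClosure K
  rw [← isIntegral_algebraMap_iff (B := L) (algebraMap K L).injective]
  let B : Matrix ι ι L := A.map (algebraMap K L)
  have htr : algebraMap K L A.trace = B.trace := by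
    simp [B, Matrix.trace]
  have hB : IsIntegral R B :=
    hA.map (((Algebra.ofId K L).restrictScalars R).mapMatrix (m := ι))
  obtain ⟨P, hP, hPB⟩ := hB
  rw [htr, Matrix.trace_eq_sum_roots_charpoly_of_splits (IsAlgClosed.splits _)]
  refine IsIntegral.multiset_sum fun μ hμ => ?_
  have hμ' : μ ∈ spectrum L B :=
    Matrix.mem_spectrum_iff_isRoot_charpoly.mpr (Polynomial.isRoot_of_mem_roots hμ)
  refine ⟨P, hP, ?_⟩
  have h1 := spectrum.subset_polynomial_aeval B (P.map (algebraMap R L)) ⟨μ, hμ', rfl⟩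
  have h2 : Polynomial.aeval B (P.map (algebraMap R L)) = 0 := by
    rw [Polynomial.aeval_map_algebraMap]; exact hPB
  rw [h2] at h1
  have : Nontrivial (Matrix ι ι L) := by
    by_contra hn
    rw [not_nontrivial_iff_subsingleton] at hn
    rw [spectrum.of_subsingleton] at h1
    exact h1
  rw [spectrum.zero_eq, Set.mem_singleton_iff] at h1
  exact (Polynomial.eval_map _ _).symm.trans h1

/-! ### Lattices and their integral functionals -/

section Lattice

variable {R K H : Type*} [CommRing R] [Field K] [Algebra R K]

/-- The linear functional `f` takes values in `R` on the `R`-submodule `X`; for a lattice `X` these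
functionals form the dual lattice. -/
def IsIntegralOn [AddCommGroup H] [Module K H] [Module R H] (X : Submodule R H)
    (f : H →ₗ[K] K) : Prop :=
  ∀ x ∈ X, f x ∈ (algebraMap R K).range

section

variable [AddCommGroup H] [Module K H] [Module R H] [IsScalarTower R K H] {X : Submodule R H}

theorem exists_dual_basis_of_isBaseChange [Module.Finite R X] [Module.Projective R X]
    (hX : IsBaseChange K X.subtype) :
    ∃ (n : ℕ) (b : Fin n → H) (f : Fin n → H →ₗ[K] K), (∀ i, b i ∈ X) ∧
      (∀ i, IsIntegralOn X (f i)) ∧ ∀ y, ∑ i, f i y • b i = y := by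
  obtain ⟨n, π, s, hπ, hs, hπs⟩ := Module.Finite.exists_comp_eq_id_of_projective R X
  let g : Fin n → X →ₗ[R] K := fun i =>
    Algebra.linearMap R K ∘ₗ LinearMap.proj i ∘ₗ s
  have hg : ∀ i (x : X), hX.lift (g i) x = algebraMap R K (s x i) := fun i x =>
    hX.lift_eq (g i) x
  refine ⟨n, fun i => π (Pi.single i 1), fun i => hX.lift (g i), fun i => (π _).2, ?_, ?_⟩
  · intro i x hx
    exact ⟨s ⟨x, hx⟩ i, (hg i ⟨x, hx⟩).symm⟩
  · have key : (∑ i, (hX.lift (g i)).smulRight ((π (Pi.single i 1) : X) : H)) =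
        (LinearMap.id : H →ₗ[K] H) := by
      refine hX.algHom_ext _ _ fun x => ?_
      have h1 : π (s x) = x := LinearMap.congr_fun hπs x
      have h2 : s x = ∑ i, s x i • (Pi.single i 1 : Fin n → R) := by
        ext j; simp [Finset.sum_apply, Pi.single_apply]
      have h3 : ∑ i, s x i • ((π (Pi.single i 1) : X) : H) = x := by
        conv_rhs => rw [← h1, h2]
        simp
      simp only [LinearMap.coe_sum, Finset.sum_apply, LinearMap.smulRight_apply,
        Submodule.subtype_apply, LinearMap.id_apply, hg, algebraMap_smul]
      exact h3
    intro y
    simpa using LinearMap.congr_fun key y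

/-- A lattice is reflexive: it is cut out by its integral functionals. -/
theorem mem_of_forall_isIntegralOn [Module.Finite R X] [Module.Projective R X]
    (hX : IsBaseChange K X.subtype) {y : H}
    (hy : ∀ f : H →ₗ[K] K, IsIntegralOn X f → f y ∈ (algebraMap R K).range) : y ∈ X := by
  obtain ⟨n, b, f, hb, hf, hbf⟩ := exists_dual_basis_of_isBaseChange hX
  rw [← hbf y]
  refine Submodule.sum_mem _ fun i _ => ?_
  obtain ⟨r, hr⟩ := hy (f i) (hf i)
  rw [← hr, algebraMap_smul]
  exact X.smul_mem r (hb i)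

/-- Every vector has a nonzero integral multiple in the lattice. -/
theorem exists_smul_mem_of_isBaseChange [IsDomain R] [IsFractionRing R K] [Module.Finite R X]
    [Module.Projective R X] (hX : IsBaseChange K X.subtype) (y : H) :
    ∃ r : R, r ≠ 0 ∧ r • y ∈ X := by
  refine hX.inductionOn y (fun y => ∃ r : R, r ≠ 0 ∧ r • y ∈ X) ?_ ?_ ?_ ?_
  · exact ⟨1, one_ne_zero, by simp⟩
  · exact fun x => ⟨1, one_ne_zero, by simp⟩
  · rintro k y ⟨r, hr, hry⟩
    obtain ⟨a, b, hb, rfl⟩ := IsFractionRing.div_surjective (A := R) k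
    have hb0 : algebraMap R K b ≠ 0 := by
      simpa using nonZeroDivisors.ne_zero hb
    refine ⟨b * r, mul_ne_zero (nonZeroDivisors.ne_zero hb) hr, ?_⟩
    have : (b * r) • (algebraMap R K a / algebraMap R K b) • y = a • r • y := by
      rw [← algebraMap_smul K (b * r), ← algebraMap_smul K a (r • y), ← algebraMap_smul K r y,
        smul_smul, smul_smul, map_mul]
      congr 1
      field_simp
    rw [this]
    exact X.smul_mem a hry
  · rintro y z ⟨r, hr, hry⟩ ⟨s, hs, hsz⟩
    refine ⟨s * r, mul_ne_zero hs hr, ?_⟩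
    rw [smul_add]
    refine X.add_mem ?_ ?_
    · rw [mul_smul]; exact X.smul_mem s hry
    · rw [mul_comm, mul_smul]; exact X.smul_mem r hsz

/-- A functional on a subspace `U` of `H` which is integral on `X ∩ U` extends to an integral
functional on `H`, because `X ∩ U` is a direct summand of `X`: the quotient is torsion-free, hence
projective over the Dedekind domain `R`. -/
theorem exists_isIntegralOn_extension [IsDedekindDomain R] [IsFractionRing R K]
    [Module.Finite R X] [Module.Projective R X] (hX : IsBaseChange K X.subtype)
    {U : Type*} [AddCommGroup U] [Module K U] (j : U →ₗ[K] H) (hj : Function.Injective j)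
    (f₀ : U →ₗ[K] K) (hf₀ : ∀ u, j u ∈ X → f₀ u ∈ (algebraMap R K).range) :
    ∃ f : H →ₗ[K] K, IsIntegralOn X f ∧ ∀ u, f (j u) = f₀ u := by
  let Y : Submodule R X := (LinearMap.range j).restrictScalars R |>.comap X.subtype
  have hY : ∀ {x : X}, x ∈ Y ↔ ∃ u, j u = x := fun {x} => Iff.rfl
  have : Module.IsTorsionFree R (X ⧸ Y) := by
    refine Module.IsTorsionFree.of_smul_eq_zero fun r q hrq => ?_
    obtain ⟨x, rfl⟩ := Y.mkQ_surjective q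
    by_cases hr : r = 0
    · exact Or.inl hr
    right
    rw [← map_smul, Submodule.mkQ_apply, Submodule.Quotient.mk_eq_zero] at hrq
    rw [Submodule.mkQ_apply, Submodule.Quotient.mk_eq_zero]
    obtain ⟨u, hu⟩ := hY.1 hrq
    have hr' : algebraMap R K r ≠ 0 := by simpa using hr
    refine hY.2 ⟨(algebraMap R K r)⁻¹ • u, ?_⟩
    rw [map_smul, hu]
    simp only [Submodule.coe_smul, ← algebraMap_smul K r (x : H)]
    rw [smul_smul, inv_mul_cancel₀ hr', one_smul]
  have : Module.FinitePresentation R (X ⧸ Y) := Module.finitePresentation_of_finite R _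
  have : Module.Projective R (X ⧸ Y) := Module.Flat.projective_of_finitePresentation
  obtain ⟨s, hs⟩ := Y.mkQ.exists_rightInverse_of_surjective
    (LinearMap.range_eq_top.2 Y.mkQ_surjective)
  have hP : ∀ x : X, x - s (Y.mkQ x) ∈ Y := fun x => by
    rw [← Submodule.Quotient.mk_eq_zero, ← Submodule.mkQ_apply, map_sub]
    have := LinearMap.congr_fun hs (Y.mkQ x)
    simp only [LinearMap.comp_apply, LinearMap.id_apply] at this
    rw [this, sub_self]
  -- The projection of `X` onto `X ∩ U` along the image of the section `s`.
  let P : X →ₗ[R] LinearMap.range j :=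
    { toFun := fun x => ⟨((x - s (Y.mkQ x) : X) : H), hP x⟩
      map_add' := fun x y => by
        ext; simp only [map_add, Submodule.coe_add, Submodule.coe_sub]; abel
      map_smul' := fun r x => by
        ext; simp [smul_sub] }
  let e := LinearEquiv.ofInjective j hj
  let g : X →ₗ[R] K := (f₀ ∘ₗ e.symm.toLinearMap).restrictScalars R ∘ₗ P
  have heq : ∀ (x : X) u, j u = ((P x : LinearMap.range j) : H) → g x = f₀ u := by
    intro x u hu
    have : P x = e u := Subtype.ext hu.symm
    simp [g, this]
  refine ⟨hX.lift g, ?_, ?_⟩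
  · intro x hx
    obtain ⟨u, hu⟩ := (P ⟨x, hx⟩).2
    have h1 : hX.lift g x = g ⟨x, hx⟩ := hX.lift_eq g ⟨x, hx⟩
    rw [h1, heq _ u hu]
    refine hf₀ u ?_
    rw [hu]
    exact (⟨x, hx⟩ - s (Y.mkQ ⟨x, hx⟩) : X).2
  · intro u
    obtain ⟨r, hr, hru⟩ := exists_smul_mem_of_isBaseChange hX (j u)
    have hr' : algebraMap R K r ≠ 0 := by simpa using hr
    have h1 : hX.lift g (r • j u) = g ⟨r • j u, hru⟩ := hX.lift_eq g ⟨_, hru⟩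
    have h2 : g ⟨r • j u, hru⟩ = f₀ (algebraMap R K r • u) := by
      refine heq _ _ ?_
      have : (⟨r • j u, hru⟩ : X) ∈ Y := hY.2 ⟨algebraMap R K r • u, by simp⟩
      have h0 : Y.mkQ ⟨r • j u, hru⟩ = 0 := by
        rwa [Submodule.mkQ_apply, Submodule.Quotient.mk_eq_zero]
      change _ = (((⟨r • j u, hru⟩ : X) - s (Y.mkQ ⟨r • j u, hru⟩) : X) : H)
      rw [h0, map_zero, sub_zero]
      simp
    rw [h2, ← algebraMap_smul K r (j u), map_smul, map_smul] at h1
    exact smul_right_injective K hr' h1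

end

end Lattice

/-! ### Hopf orders -/

namespace IsHopfOrder

variable {R K H : Type*} [CommRing R] [Field K] [Algebra R K] [Ring H] [HopfAlgebra K H]
  [Module R H] [IsScalarTower R K H] {X : Submodule R H}

theorem lid_rTensor_mem {f : H →ₗ[K] K} (hf : IsIntegralOn X f) {z : H ⊗[K] H}
    (hz : z ∈ tensorSquare K X) : TensorProduct.lid K H (f.rTensor H z) ∈ X := by
  induction hz using Submodule.span_induction with
  | mem z hz =>
    obtain ⟨x, hx, y, hy, rfl⟩ := hz
    obtain ⟨r, hr⟩ := hf x hx
    simp only [LinearMap.rTensor_tmul, TensorProduct.lid_tmul, ← hr, algebraMap_smul]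
    exact X.smul_mem r hy
  | zero => simp
  | add y z _ _ hy hz => simpa only [map_add] using X.add_mem hy hz
  | smul r z _ hz =>
    rw [← algebraMap_smul K r z, map_smul, map_smul, algebraMap_smul]
    exact X.smul_mem r hz

theorem isIntegralOn_counit (hX : IsHopfOrder K X) :
    IsIntegralOn X (Coalgebra.counit (R := K) (A := H)) :=
  fun x hx => hX.counit_mem x hx

/-- The dual lattice of a Hopf order is closed under convolution. -/
theorem isIntegralOn_convolution (hX : IsHopfOrder K X) {f g : H →ₗ[K] K} (hf : IsIntegralOn X f)
    (hg : IsIntegralOn X g) :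
    IsIntegralOn X (g ∘ₗ (TensorProduct.lid K H).toLinearMap ∘ₗ f.rTensor H ∘ₗ
      Coalgebra.comul) :=
  fun x hx => hg _ (lid_rTensor_mem hf (hX.comul_mem x hx))

/-- If `c` is the matrix of a comodule of `H`, then its trace lies in every Hopf order: evaluating
`c` at the integral functionals yields a finitely generated ring of matrices over `R`, whose traces
are integral. -/
theorem trace_comatrix_mem [IsIntegrallyClosed R] [IsFractionRing R K]
    (hX : IsHopfOrder K X) {ι : Type*} [Fintype ι] [DecidableEq ι] (c : ι → ι → H)
    (hcounit : ∀ i k, Coalgebra.counit (R := K) (c i k) = (1 : Matrix ι ι K) i k)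
    (hcomul : ∀ i k, Coalgebra.comul (R := K) (c i k) = ∑ l, c i l ⊗ₜ[K] c l k) :
    ∑ i, c i i ∈ X := by
  have := hX.finite
  have := hX.projective
  refine mem_of_forall_isIntegralOn hX.isBaseChange fun f hf => ?_
  obtain ⟨n, b, φ, hb, hφ, hbφ⟩ := exists_dual_basis_of_isBaseChange hX.isBaseChange
  let ev : (H →ₗ[K] K) → Matrix ι ι K := fun f => Matrix.of fun i k => f (c i k)
  have hev : ∀ f, IsIntegralOn X f → ev f ∈ Submodule.span R (Set.range fun i => ev (φ i)) := by
    intro f hf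
    have : ev f = ∑ i, f (b i) • ev (φ i) := by
      ext s t
      have := congrArg f (hbφ (c s t))
      rw [map_sum] at this
      simp [ev, Matrix.sum_apply, ← this, mul_comm]
    rw [this]
    refine Submodule.sum_mem _ fun i _ => ?_
    obtain ⟨r, hr⟩ := hf (b i) (hb i)
    rw [← hr, algebraMap_smul]
    exact Submodule.smul_mem _ r (Submodule.subset_span ⟨i, rfl⟩)
  have hint : IsIntegral R (ev f) := by
    refine Submodule.isIntegral_of_fg_of_mul_mem
      (Submodule.fg_span (Set.finite_range fun i => ev (φ i))) ?_ ?_ (hev f hf)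
    · convert hev _ hX.isIntegralOn_counit
      ext i k
      simp [ev, hcounit]
    · have hmul : ∀ f g, ev f * ev g = ev (g ∘ₗ (TensorProduct.lid K H).toLinearMap ∘ₗ
          f.rTensor H ∘ₗ Coalgebra.comul) := by
        intro f g
        ext i k
        simp [ev, Matrix.mul_apply, hcomul, map_sum]
      intro x hx y hy
      have h2 := Submodule.mul_mem_mul hx hy
      rw [Submodule.span_mul_span] at h2
      refine Submodule.span_le.2 ?_ h2
      rintro _ ⟨_, ⟨i, rfl⟩, _, ⟨k, rfl⟩, rfl⟩
      change ev (φ i) * ev (φ k) ∈ _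
      rw [hmul]
      exact hev _ (hX.isIntegralOn_convolution (hφ i) (hφ k))
  obtain ⟨r, hr⟩ := IsIntegrallyClosed.isIntegral_iff.1 (Matrix.isIntegral_trace hint)
  exact ⟨r, by simp [hr, Matrix.trace, ev]⟩

/-- The trace of a matrix representation of a subalgebra `A` is integral at every element of `A` that
lies in `X`. -/
theorem trace_representation_mem [IsDomain R] [IsNoetherianRing R] [IsIntegrallyClosed R]
    [IsFractionRing R K] (hX : IsHopfOrder K X) {ι A : Type*} [Fintype ι] [DecidableEq ι]
    [Ring A] [Algebra K A] (j : A →ₐ[K] H) (hj : Function.Injective j)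
    (ρ : A →ₐ[K] Matrix ι ι K) {a : A} (ha : j a ∈ X) :
    (ρ a).trace ∈ (algebraMap R K).range := by
  have := hX.finite
  let _ : Module R A := Module.compHom A (algebraMap R K)
  have : IsScalarTower R K A := ⟨fun r k a => by
    rw [Algebra.smul_def r k, mul_smul]; rfl⟩
  let Y : Submodule R A := X.comap (j.toLinearMap.restrictScalars R)
  have hY : Module.Finite R Y := by
    let g : Y →ₗ[R] X := (j.toLinearMap.restrictScalars R).restrict fun y hy => hy
    have hg : Function.Injective g := fun y z h =>
      Subtype.ext (hj (congrArg (Subtype.val : X → H) h))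
    exact Module.Finite.of_injective g hg
  let S : Submodule R (Matrix ι ι K) := Y.map (ρ.toLinearMap.restrictScalars R)
  have hS : IsIntegral R (ρ a) := by
    refine Submodule.isIntegral_of_fg_of_mul_mem (S := S)
      (Submodule.FG.map _ (Module.Finite.iff_fg.1 hY)) ⟨1, ?_, by simp⟩ ?_ ⟨a, ha, rfl⟩
    · simpa [Y] using hX.one_mem
    · rintro _ ⟨x, hx, rfl⟩ _ ⟨y, hy, rfl⟩
      refine ⟨x * y, ?_, by simp⟩
      simpa [Y] using hX.mul_mem _ hx _ hy
  obtain ⟨r, hr⟩ := IsIntegrallyClosed.isIntegral_iff.1 (Matrix.isIntegral_trace hS)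
  exact ⟨r, hr⟩

end IsHopfOrder

/-! ### Twists by a two-cocycle on the dual of an abelian group -/

/-- A family `e` of elements of the Hopf algebra `H`, indexed by a finite abelian group `B`, which
multiplies and comultiplies like the indicator functions in the function algebra of `B`. When `B`
is the character group of an abelian group `M`, these are the primitive idempotents of the group
algebra of `M`. -/
structure IsIndicatorFamily (K : Type*) [Field K] {H : Type*} [Ring H] [HopfAlgebra K H]
    {B : Type*} [AddCommGroup B] [Fintype B] [DecidableEq B] (e : B → H) : Prop where
  mul_eq : ∀ a b, e a * e b = if a = b then e a else 0
  sum_eq_one : ∑ a, e a = 1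
  comul_eq : ∀ a, Coalgebra.comul (R := K) (e a) = ∑ b, e b ⊗ₜ[K] e (a - b)
  counit_eq : ∀ a, Coalgebra.counit (R := K) (e a) = if a = 0 then 1 else 0

namespace IsIndicatorFamily

variable {K : Type*} [Field K] {H : Type*} [Ring H] [HopfAlgebra K H]
  {B : Type*} [AddCommGroup B] [Fintype B] [DecidableEq B] {e : B → H}

/-- The element `∑ f(a, b) e_a ⊗ e_b` of `H ⊗ H`. -/
def tensorSum (K : Type*) [Field K] {H : Type*} [Ring H] [HopfAlgebra K H]
    {B : Type*} [Fintype B] (e : B → H) (f : B → B → K) : H ⊗[K] H :=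
  ∑ a, ∑ b, f a b • (e a ⊗ₜ[K] e b)

theorem tensorSum_mul_tmul (he : IsIndicatorFamily K e) (f : B → B → K) (a b : B) :
    tensorSum K e f * (e a ⊗ₜ[K] e b) = f a b • (e a ⊗ₜ[K] e b) := by
  simp only [tensorSum, Finset.sum_mul, smul_mul_assoc, Algebra.TensorProduct.tmul_mul_tmul,
    he.mul_eq]
  rw [Finset.sum_eq_single a, Finset.sum_eq_single b]
  · simp
  · intro c _ hc; simp [hc]
  · simp
  · intro c _ hc; simp [hc]
  · simp

theorem tmul_mul_tensorSum (he : IsIndicatorFamily K e) (f : B → B → K) (a b : B) :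
    (e a ⊗ₜ[K] e b) * tensorSum K e f = f a b • (e a ⊗ₜ[K] e b) := by
  simp only [tensorSum, Finset.mul_sum, mul_smul_comm, Algebra.TensorProduct.tmul_mul_tmul,
    he.mul_eq]
  rw [Finset.sum_eq_single a, Finset.sum_eq_single b]
  · simp
  · intro c _ hc; simp [hc.symm]
  · simp
  · intro c _ hc; simp [hc.symm]
  · simp

theorem tensorSum_mul_tensorSum (he : IsIndicatorFamily K e) (f g : B → B → K) :
    tensorSum K e f * tensorSum K e g = tensorSum K e fun a b => f a b * g a b := by
  conv_lhs => rw [tensorSum.eq_1 K e g]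
  simp only [Finset.mul_sum, mul_smul_comm, he.tensorSum_mul_tmul, smul_smul]
  simp only [tensorSum, mul_comm]

theorem tensorSum_one (he : IsIndicatorFamily K e) : (tensorSum K e fun _ _ => 1) = 1 := by
  simp only [tensorSum, one_smul, ← TensorProduct.tmul_sum, ← TensorProduct.sum_tmul,
    he.sum_eq_one, Algebra.TensorProduct.one_def]

theorem tensorSum_mul_comul (he : IsIndicatorFamily K e) (f : B → B → K) (c : B) :
    tensorSum K e f * Coalgebra.comul (R := K) (e c) =
      ∑ a, f a (c - a) • (e a ⊗ₜ[K] e (c - a)) := by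
  simp only [he.comul_eq, Finset.mul_sum, he.tensorSum_mul_tmul]

theorem comul_mul_tensorSum (he : IsIndicatorFamily K e) (f : B → B → K) (c : B) :
    Coalgebra.comul (R := K) (e c) * tensorSum K e f =
      ∑ a, f a (c - a) • (e a ⊗ₜ[K] e (c - a)) := by
  simp only [he.comul_eq, Finset.sum_mul, he.tmul_mul_tensorSum]

/-- The Drinfeld twist `∑ ω(a, b) e_a ⊗ e_b` attached to a normalized two-cocycle `ω`. -/
def twist (he : IsIndicatorFamily K e) (ω : B → B → Kˣ)
    (hω : ∀ a b c, ω a b * ω (a + b) c = ω b c * ω a (b + c))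
    (hleft : ∀ a, ω 0 a = 1) (hright : ∀ a, ω a 0 = 1) : DrinfeldTwist K H where
  elt :=
    { val := tensorSum K e fun a b => ω a b
      inv := tensorSum K e fun a b => ↑(ω a b)⁻¹
      val_inv := by simp [he.tensorSum_mul_tensorSum, he.tensorSum_one]
      inv_val := by simp [he.tensorSum_mul_tensorSum, he.tensorSum_one] }
  cocycle := by
    have h1 : ((1 : H) ⊗ₜ[K] (tensorSum K e fun a b => (ω a b : K))) *
        (Coalgebra.comul (R := K) (A := H)).lTensor H (tensorSum K e fun a b => (ω a b : K)) =
        ∑ a, ∑ c, ∑ b, ((ω b c * ω a (b + c) : Kˣ) : K) • (e a ⊗ₜ[K] (e b ⊗ₜ[K] e c)) := by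
      conv_lhs => enter [2]; rw [tensorSum]
      simp only [map_sum, map_smul, LinearMap.lTensor_tmul, Finset.mul_sum, mul_smul_comm,
        Algebra.TensorProduct.tmul_mul_tmul, one_mul, he.tensorSum_mul_comul,
        TensorProduct.tmul_sum, TensorProduct.tmul_smul, Finset.smul_sum, smul_smul]
      refine Finset.sum_congr rfl fun a _ => ?_
      rw [Finset.sum_comm]
      conv_rhs => rw [Finset.sum_comm]
      refine Finset.sum_congr rfl fun b _ => ?_
      refine Fintype.sum_equiv (Equiv.subRight b) _ _ fun c => ?_
      simp [mul_comm]
    have h2 : (((tensorSum K e fun a b => (ω a b : K))) ⊗ₜ[K] (1 : H)) *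
        (Coalgebra.comul (R := K) (A := H)).rTensor H (tensorSum K e fun a b => (ω a b : K)) =
        ∑ c, ∑ a, ∑ b, ((ω a b * ω (a + b) c : Kˣ) : K) • ((e a ⊗ₜ[K] e b) ⊗ₜ[K] e c) := by
      conv_lhs => enter [2]; rw [tensorSum]
      simp only [map_sum, map_smul, LinearMap.rTensor_tmul, Finset.mul_sum, mul_smul_comm,
        Algebra.TensorProduct.tmul_mul_tmul, one_mul, he.tensorSum_mul_comul,
        TensorProduct.sum_tmul, ← TensorProduct.smul_tmul', Finset.smul_sum, smul_smul]
      rw [Finset.sum_comm]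
      refine Finset.sum_congr rfl fun c _ => ?_
      rw [Finset.sum_comm]
      refine Finset.sum_congr rfl fun a _ => ?_
      refine Fintype.sum_equiv (Equiv.subRight a) _ _ fun b => ?_
      simp [mul_comm]
    rw [h1, h2]
    simp only [map_sum, map_smul, TensorProduct.assoc_tmul, hω]
    rw [Finset.sum_comm]
  counit_left := by
    simp only [tensorSum, map_sum, map_smul, LinearMap.rTensor_tmul, he.counit_eq,
      TensorProduct.lid_tmul]
    rw [Finset.sum_eq_single 0]
    · simp [hleft, he.sum_eq_one]
    · intro a _ ha; simp [ha]
    · simp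
  counit_right := by
    simp only [tensorSum, map_sum, map_smul, LinearMap.lTensor_tmul, he.counit_eq,
      TensorProduct.rid_tmul]
    rw [Finset.sum_comm, Finset.sum_eq_single 0]
    · simp [hright, he.sum_eq_one]
    · intro a _ ha; simp [ha]
    · simp

end IsIndicatorFamily

/-! ### The twist by a bicharacter -/

section Bicharacter

variable {K : Type*} [Field K] {A : Type*} [CommRing A]

/-- The bicharacter `((a₁, a₂), (b₁, b₂)) ↦ ψ(a₁ b₂)` on `A × A`. When `ψ` is primitive, its
alternation is nondegenerate. -/
def bicharacter (ψ : AddChar A K) (a b : A × A) : Kˣ :=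
  ψ.toMonoidHom.toHomUnits (Multiplicative.ofAdd (a.1 * b.2))

theorem coe_bicharacter (ψ : AddChar A K) (a b : A × A) :
    (bicharacter ψ a b : K) = ψ (a.1 * b.2) :=
  rfl

theorem coe_bicharacter_inv (ψ : AddChar A K) (a b : A × A) :
    ((bicharacter ψ a b)⁻¹ : Kˣ) = ψ (-(a.1 * b.2)) := by
  rw [Units.val_inv_eq_inv_val, coe_bicharacter, AddChar.map_neg_eq_inv]

theorem bicharacter_cocycle (ψ : AddChar A K) (a b c : A × A) :
    bicharacter ψ a b * bicharacter ψ (a + b) c = bicharacter ψ b c * bicharacter ψ a (b + c) := by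
  ext
  simp only [Units.val_mul, coe_bicharacter, ← AddChar.map_add_eq_mul]
  congr 1
  simp only [Prod.fst_add, Prod.snd_add]
  ring

theorem bicharacter_zero_left (ψ : AddChar A K) (a : A × A) : bicharacter ψ 0 a = 1 := by
  ext; simp [coe_bicharacter]

theorem bicharacter_zero_right (ψ : AddChar A K) (a : A × A) : bicharacter ψ a 0 = 1 := by
  ext; simp [coe_bicharacter]

namespace IsIndicatorFamily

variable [Fintype A] [DecidableEq A] {H : Type*} [Ring H] [HopfAlgebra K H] {e : A × A → H}

/-- The Drinfeld twist attached to the bicharacter of `ψ`. -/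
def bicharacterTwist (he : IsIndicatorFamily K e) (ψ : AddChar A K) : DrinfeldTwist K H :=
  he.twist (bicharacter ψ) (bicharacter_cocycle ψ) (bicharacter_zero_left ψ)
    (bicharacter_zero_right ψ)

theorem bicharacterTwist_elt (he : IsIndicatorFamily K e) (ψ : AddChar A K) :
    ((he.bicharacterTwist ψ).elt : H ⊗[K] H) = tensorSum K e fun a b => ψ (a.1 * b.2) :=
  rfl

theorem bicharacterTwist_elt_inv (he : IsIndicatorFamily K e) (ψ : AddChar A K) :
    (↑(he.bicharacterTwist ψ).elt⁻¹ : H ⊗[K] H) = tensorSum K e fun a b => ψ (-(a.1 * b.2)) := by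
  change tensorSum K e (fun a b => ((bicharacter ψ a b)⁻¹ : Kˣ)) = _
  simp only [coe_bicharacter_inv]

/-- The entry `(s, t)` of the matrix of a comodule of dimension `|A|` over the span of the `e_a`,
whose coproduct `Δ` is replaced by the product of `Δ` with the tensor of the bicharacter of `ψ`. In
dual terms: the twisted group algebra of `A × A` acts on the functions on `A` by translations and
by multiplication with characters. -/
def comatrix (e : A × A → H) (ψ : AddChar A K) (s t : A) : H :=
  ∑ a, ψ (a * t) • e (a, s - t)

/-- The matrix coalgebra identity, for the coproduct multiplied on the left. -/
theorem tensorSum_mul_comul_comatrix (he : IsIndicatorFamily K e) (ψ : AddChar A K) (s t : A) :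
    (tensorSum K e fun a b => ψ (a.1 * b.2)) * Coalgebra.comul (R := K) (comatrix e ψ s t) =
      ∑ k, comatrix e ψ s k ⊗ₜ[K] comatrix e ψ k t := by
  simp only [comatrix, map_sum, map_smul, Finset.mul_sum, mul_smul_comm, he.tensorSum_mul_comul,
    TensorProduct.sum_tmul, TensorProduct.tmul_sum, Finset.smul_sum, smul_smul,
    ← TensorProduct.smul_tmul', TensorProduct.tmul_smul, Fintype.sum_prod_type]
  -- Substitute `b = s - k` for the second coordinate and `a - a'` for the first one.
  calc ∑ a : A, ∑ a' : A, ∑ b : A, (ψ (a * t) * ψ (a' * ((a, s - t) - (a', b)).2)) •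
        (e (a', b) ⊗ₜ[K] e ((a, s - t) - (a', b)))
      = ∑ a' : A, ∑ b : A, ∑ a : A, (ψ ((a' + a) * t) * ψ (a' * (s - t - b))) •
        (e (a', b) ⊗ₜ[K] e (a, s - t - b)) := by
        rw [Finset.sum_comm]
        refine Finset.sum_congr rfl fun a' _ => ?_
        rw [Finset.sum_comm]
        refine Finset.sum_congr rfl fun b _ => ?_
        refine Fintype.sum_equiv (Equiv.subRight a') _ _ fun a => ?_
        simp
    _ = ∑ k : A, ∑ a : A, ∑ a' : A, (ψ (a' * k) * ψ (a * t)) •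
        (e (a', s - k) ⊗ₜ[K] e (a, k - t)) := by
        rw [Finset.sum_comm]
        refine Fintype.sum_equiv (Equiv.subLeft s) _ _ fun b => ?_
        rw [Finset.sum_comm]
        refine Finset.sum_congr rfl fun a _ => Finset.sum_congr rfl fun a' _ => ?_
        simp only [Equiv.subLeft_apply, sub_sub_cancel, sub_right_comm s b t,
          ← AddChar.map_add_eq_mul]
        congr 2
        ring
    _ = _ := by
        refine Finset.sum_congr rfl fun k _ => ?_
        simp only [mul_comm]

theorem comul_comatrix_mul_tensorSum (he : IsIndicatorFamily K e) (ψ : AddChar A K) (s t : A) :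
    Coalgebra.comul (R := K) (comatrix e ψ s t) * (tensorSum K e fun a b => ψ (a.1 * b.2)) =
      ∑ k, comatrix e ψ s k ⊗ₜ[K] comatrix e ψ k t := by
  rw [← he.tensorSum_mul_comul_comatrix]
  simp only [comatrix, map_sum, map_smul, Finset.mul_sum, Finset.sum_mul, mul_smul_comm,
    smul_mul_assoc, he.tensorSum_mul_comul, he.comul_mul_tensorSum]

theorem counit_comatrix (he : IsIndicatorFamily K e) (ψ : AddChar A K) (s t : A) :
    Coalgebra.counit (R := K) (comatrix e ψ s t) = if s = t then 1 else 0 := by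
  simp only [comatrix, map_sum, map_smul, he.counit_eq, Prod.mk_eq_zero, sub_eq_zero]
  rw [Finset.sum_eq_single 0]
  · simp
  · intro a _ ha; simp [ha]
  · simp

/-- The character of this comodule is supported on the trivial element of `A × A`. -/
theorem sum_comatrix_self {ψ : AddChar A K} (hψ : ψ.IsPrimitive) :
    ∑ s, comatrix e ψ s s = (Fintype.card A : K) • e 0 := by
  have hsum : ∀ a : A, ∑ s, ψ (a * s) = if a = 0 then (Fintype.card A : K) else 0 := fun a => by
    have := AddChar.sum_mulShift a hψ
    simp only [mul_comm _ a] at this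
    rw [this]
    split_ifs <;> simp
  simp only [comatrix, sub_self]
  rw [Finset.sum_comm]
  simp only [← Finset.sum_smul, hsum]
  rw [Finset.sum_eq_single 0]
  · simp [Prod.zero_eq_mk]
  · intro a _ ha; simp [ha]
  · simp

end IsIndicatorFamily

end Bicharacter

/-! ### Hopf orders of the twisted algebra -/

namespace IsIndicatorFamily

variable {K : Type*} [Field K] {A : Type*} [CommRing A] [Fintype A] [DecidableEq A]
  {H : Type*} [Ring H] [HopfAlgebra K H] {e : A × A → H}

/-- The coefficients of the comodule obtained from a left comatrix for `ψ` and a right one for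
`ψ⁻¹`, with a grouplike element `h` between them. -/
theorem twisted_comul_comatrix (he : IsIndicatorFamily K e) (ψ : AddChar A K) {h : H}
    (hh : Coalgebra.comul (R := K) h = h ⊗ₜ[K] h) (s t : A × A) :
    Coalgebra.comul (R := K) (A := (he.bicharacterTwist ψ).Twisted)
        (comatrix e ψ s.1 t.1 * h * comatrix e ψ⁻¹ s.2 t.2 : H) =
      ((∑ k : A × A, (comatrix e ψ s.1 k.1 * h * comatrix e ψ⁻¹ s.2 k.2) ⊗ₜ[K]
        (comatrix e ψ k.1 t.1 * h * comatrix e ψ⁻¹ k.2 t.2) : H ⊗[K] H)) := by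
  have hinv : (tensorSum K e fun a b => ψ (-(a.1 * b.2))) =
      tensorSum K e fun a b => ψ⁻¹ (a.1 * b.2) := by
    simp only [AddChar.inv_apply]
  rw [DrinfeldTwist.twisted_comul, Bialgebra.comul_mul, Bialgebra.comul_mul, hh,
    bicharacterTwist_elt, bicharacterTwist_elt_inv, hinv, ← mul_assoc, ← mul_assoc, mul_assoc _ _
    (tensorSum K e fun a b => ψ⁻¹ (a.1 * b.2)), he.tensorSum_mul_comul_comatrix,
    he.comul_comatrix_mul_tensorSum, Fintype.sum_prod_type]
  simp only [Finset.sum_mul, Finset.mul_sum, Algebra.TensorProduct.tmul_mul_tmul]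
  exact Finset.sum_comm

/-- Every Hopf order of the twist contains `|A|² e₀ h e₀` for `h` grouplike: this element is the
trace of a comodule of dimension `|A|²`. -/
theorem card_sq_smul_mem (he : IsIndicatorFamily K e) {ψ : AddChar A K} (hψ : ψ.IsPrimitive)
    {R : Type*} [CommRing R] [Algebra R K] [IsIntegrallyClosed R] [IsFractionRing R K]
    [Module R (he.bicharacterTwist ψ).Twisted] [IsScalarTower R K (he.bicharacterTwist ψ).Twisted]
    {X : Submodule R (he.bicharacterTwist ψ).Twisted} (hX : IsHopfOrder K X) {h : H}
    (hh : Coalgebra.comul (R := K) h = h ⊗ₜ[K] h) (hh' : Coalgebra.counit (R := K) h = 1) :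
    ((Fintype.card A : K) ^ 2 • (e 0 * h * e 0) : H) ∈ X := by
  have hψ' : (ψ⁻¹).IsPrimitive := fun a ha h0 => hψ ha (by
    ext x
    have := DFunLike.congr_fun h0 x
    simp only [AddChar.mulShift_apply, AddChar.inv_apply, AddChar.one_apply] at this ⊢
    rw [AddChar.map_neg_eq_inv, inv_eq_one] at this
    exact this)
  have key := hX.trace_comatrix_mem (ι := A × A)
    (fun s t => (comatrix e ψ s.1 t.1 * h * comatrix e ψ⁻¹ s.2 t.2 : H)) ?_
    (he.twisted_comul_comatrix ψ hh)
  · have hsum : ((Fintype.card A : K) ^ 2 • (e 0 * h * e 0) : H) =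
        ∑ i : A × A, (comatrix e ψ i.1 i.1 * h * comatrix e ψ⁻¹ i.2 i.2 : H) := by
      simp only [Fintype.sum_prod_type, ← Finset.mul_sum, ← Finset.sum_mul, sum_comatrix_self hψ,
        sum_comatrix_self hψ', smul_mul_assoc, mul_smul_comm, ← Finset.smul_sum, smul_smul, sq]
    rw [hsum]
    exact key
  · intro s t
    rw [DrinfeldTwist.twisted_counit]
    simp only [Bialgebra.counit_mul, he.counit_comatrix, hh', Matrix.one_apply, Prod.ext_iff,
      mul_one]
    split_ifs <;> simp_all

theorem twisted_comul_mul_mul (he : IsIndicatorFamily K e) (ψ : AddChar A K) {g : H}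
    (hg : Coalgebra.comul (R := K) g = g ⊗ₜ[K] g) :
    Coalgebra.comul (R := K) (A := (he.bicharacterTwist ψ).Twisted) (e 0 * g * e 0 : H) =
      ((∑ a, ∑ b, (ψ (a.1 * (-a).2) * ψ (-(b.1 * (-b).2))) • ((e a * g * e b) ⊗ₜ[K]
        (e (-a) * g * e (-b))) : H ⊗[K] H)) := by
  rw [DrinfeldTwist.twisted_comul, Bialgebra.comul_mul, Bialgebra.comul_mul, hg,
    bicharacterTwist_elt, bicharacterTwist_elt_inv, ← mul_assoc, ← mul_assoc, mul_assoc _ _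
    (tensorSum K e fun a b => ψ (-(a.1 * b.2))), he.tensorSum_mul_comul, he.comul_mul_tensorSum]
  simp only [Finset.sum_mul, Finset.mul_sum, Algebra.TensorProduct.tmul_mul_tmul, zero_sub,
    smul_mul_assoc, mul_smul_comm, Finset.smul_sum, smul_smul]
  rw [Finset.sum_comm]
  simp only [mul_comm]
  rfl

/-- The integrality condition that a Hopf order of the twist imposes on the representations `ρ` of a
subalgebra containing the `e_a` and the grouplike elements `g` and `h`. With
`c = |A|² e₀ h e₀`, the functional `tr ρ(c ·)` is integral, and contracting the coproduct of
`e₀ g e₀` with it multiplies `e₀ g e₀` by the trace in the statement; so this scalar preserves the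
nonzero lattice of multiples of `e₀ g e₀` in `X`. -/
theorem card_sq_mul_trace_mem {A₀ : Type*} [Ring A₀] [Algebra K A₀] {e₀ : A × A → A₀}
    (j : A₀ →ₐ[K] H) (hj : Function.Injective j)
    (he : IsIndicatorFamily K e) (hje : ∀ a, j (e₀ a) = e a) {ψ : AddChar A K} (hψ : ψ.IsPrimitive)
    {R : Type*} [CommRing R] [Algebra R K] [IsDedekindDomain R] [IsFractionRing R K]
    [Module R (he.bicharacterTwist ψ).Twisted] [IsScalarTower R K (he.bicharacterTwist ψ).Twisted]
    {X : Submodule R (he.bicharacterTwist ψ).Twisted} (hX : IsHopfOrder K X) {g h : A₀}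
    (hg : Coalgebra.comul (R := K) (j g) = j g ⊗ₜ[K] j g)
    (hg' : Coalgebra.counit (R := K) (j g) = 1)
    (hh : Coalgebra.comul (R := K) (j h) = j h ⊗ₜ[K] j h)
    (hh' : Coalgebra.counit (R := K) (j h) = 1)
    {ι : Type*} [Fintype ι] [DecidableEq ι] (ρ : A₀ →ₐ[K] Matrix ι ι K) :
    (Fintype.card A : K) ^ 2 * (ρ (e₀ 0 * h * e₀ 0 * g)).trace ∈ (algebraMap R K).range := by
  obtain rfl : (fun a => j (e₀ a)) = e := funext hje
  have := hX.finite
  have := hX.projective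
  let T := (he.bicharacterTwist ψ).Twisted
  let j' : A₀ →ₐ[K] T := j
  have hj' : Function.Injective j' := hj
  let c : A₀ := (Fintype.card A : K) ^ 2 • (e₀ 0 * h * e₀ 0)
  have hc : j' c ∈ X := by
    have h1 := he.card_sq_smul_mem hψ hX hh hh'
    have h2 : j c = (Fintype.card A : K) ^ 2 • (j (e₀ 0) * j h * j (e₀ 0)) := by simp [c]
    rw [← h2] at h1
    exact h1
  let f₀ : A₀ →ₗ[K] K := Matrix.traceLinearMap ι K K ∘ₗ ρ.toLinearMap ∘ₗ LinearMap.mulLeft K c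
  have hf₀ : ∀ a, f₀ a = (ρ (c * a)).trace := fun a => rfl
  obtain ⟨f, hf, hff₀⟩ := exists_isIntegralOn_extension hX.isBaseChange j'.toLinearMap hj' f₀
    (fun a ha => by
      rw [hf₀]
      exact hX.trace_representation_mem j' hj' ρ (by
        rw [map_mul]
        exact hX.mul_mem _ hc _ ha))
  -- By cyclicity of the trace, the functional detects only the term `a = b = 0` of the coproduct.
  have hmul₀ : ∀ a b, e₀ a * e₀ b = if a = b then e₀ a else 0 := fun a b => hj (by
    rw [map_mul, he.mul_eq]; split_ifs <;> simp)
  set t : K := (Fintype.card A : K) ^ 2 * (ρ (e₀ 0 * h * e₀ 0 * g)).trace with ht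
  have hf_apply : ∀ a b, f₀ (e₀ a * g * e₀ b) = if a = 0 ∧ b = 0 then t else 0 := by
    intro a b
    have h1 : f₀ (e₀ a * g * e₀ b) =
        (Fintype.card A : K) ^ 2 * (ρ ((e₀ b * e₀ 0) * h * (e₀ 0 * e₀ a) * g)).trace := by
      rw [hf₀]
      simp only [c, smul_mul_assoc, map_smul, Matrix.trace_smul, smul_eq_mul]
      congr 1
      have : e₀ 0 * h * e₀ 0 * (e₀ a * g * e₀ b) = (e₀ 0 * h * (e₀ 0 * e₀ a) * g) * e₀ b := by
        simp only [mul_assoc]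
      rw [this, map_mul, Matrix.trace_mul_comm, ← map_mul]
      simp only [mul_assoc]
    rw [h1, hmul₀, hmul₀]
    by_cases ha : a = 0
    · by_cases hb : b = 0
      · simp [ha, hb, ht]
      · simp [hb]
    · simp [ha, Ne.symm ha]
  let y : H := j (e₀ 0) * j g * j (e₀ 0)
  let z : T := y
  have hcontract : TensorProduct.lid K T (f.rTensor T (Coalgebra.comul (R := K) z)) = t • z := by
    have h1 : Coalgebra.comul (R := K) z = (∑ a, ∑ b,
        (ψ (a.1 * (-a).2) * ψ (-(b.1 * (-b).2))) • ((j' (e₀ a * g * e₀ b)) ⊗ₜ[K]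
        (j' (e₀ (-a) * g * e₀ (-b)))) : T ⊗[K] T) := by
      refine (he.twisted_comul_mul_mul ψ hg).trans ?_
      simp only [← map_mul]
      rfl
    have h2 : ∀ a, f (j' a) = f₀ a := hff₀
    rw [h1]
    simp only [map_sum, map_smul, LinearMap.rTensor_tmul, TensorProduct.lid_tmul, h2, hf_apply]
    rw [Finset.sum_eq_single 0, Finset.sum_eq_single 0]
    · simp only [Prod.fst_zero, zero_mul, neg_zero, AddChar.map_zero_eq_one, and_self, if_true,
        one_smul, mul_one]
      congr 1
      change j (e₀ 0 * g * e₀ 0) = _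
      rw [map_mul, map_mul]
    · intro b _ hb; simp [hb]
    · simp
    · intro a _ ha; simp [ha]
    · simp
  have hmem : ∀ x ∈ X, ∀ k : K, x = k • z → t • x ∈ X := by
    rintro x hx k rfl
    have := IsHopfOrder.lid_rTensor_mem hf (hX.comul_mem _ hx)
    rw [map_smul, map_smul, map_smul, hcontract, smul_comm] at this
    exact this
  -- The multiples of `e₀ g e₀` in `X` form a nonzero finitely generated module preserved by `t`.
  let N : Submodule R T := X ⊓ (Submodule.span K {z}).restrictScalars R
  have hz : z ≠ 0 := by
    intro h0
    have h1 : Coalgebra.counit (R := K) y = 0 := by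
      rw [show y = 0 from h0, map_zero]
    simp only [y, Bialgebra.counit_mul, hg', he.counit_eq] at h1
    simp at h1
  have hN : N ≠ ⊥ := by
    obtain ⟨r, hr, hrz⟩ := exists_smul_mem_of_isBaseChange hX.isBaseChange z
    intro h0
    have h1 : r • z ∈ N := ⟨hrz, by
      rw [← algebraMap_smul K r z]
      exact Submodule.smul_mem _ _ (Submodule.mem_span_singleton_self z)⟩
    rw [h0, Submodule.mem_bot, ← algebraMap_smul K r z, smul_eq_zero] at h1
    rcases h1 with h1 | h1
    · exact hr (by simpa using h1)
    · exact hz h1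
  have hfg : N.FG := by
    have : Module.Finite R N := Module.Finite.of_injective (Submodule.inclusion inf_le_left)
      (Submodule.inclusion_injective (inf_le_left : N ≤ X))
    exact Module.Finite.iff_fg.1 this
  have hint : IsIntegral R t := by
    refine isIntegral_of_smul_mem_submodule N hN hfg t ?_
    rintro x ⟨hx, hxz⟩
    obtain ⟨k, rfl⟩ := Submodule.mem_span_singleton.1 hxz
    exact ⟨hmem _ hx k rfl, Submodule.smul_mem (Submodule.span K {z}) t hxz⟩
  obtain ⟨r, hr⟩ := IsIntegrallyClosed.isIntegral_iff.1 hint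
  exact ⟨r, hr⟩

end IsIndicatorFamily

/-! ### Twists of a group algebra from a subgroup isomorphic to `A × A` -/

section GroupAlgebra

variable {K : Type*} [Field K] {A : Type*} [CommRing A]

/-- The character `x ↦ ψ(a₁ x₁ + a₂ x₂)` of `A × A`. -/
def prodChar (ψ : AddChar A K) (a x : A × A) : K :=
  ψ (a.1 * x.1 + a.2 * x.2)

theorem prodChar_add_right (ψ : AddChar A K) (a x y : A × A) :
    prodChar ψ a (x + y) = prodChar ψ a x * prodChar ψ a y := by
  rw [prodChar, prodChar, prodChar, ← AddChar.map_add_eq_mul]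
  congr 1; simp only [Prod.fst_add, Prod.snd_add]; ring

theorem prodChar_comm (ψ : AddChar A K) (a x : A × A) : prodChar ψ a x = prodChar ψ x a := by
  simp only [prodChar, mul_comm]

theorem prodChar_add_left (ψ : AddChar A K) (a b x : A × A) :
    prodChar ψ (a + b) x = prodChar ψ a x * prodChar ψ b x := by
  simp only [prodChar_comm ψ _ x, prodChar_add_right]

@[simp] theorem prodChar_zero_right (ψ : AddChar A K) (a : A × A) : prodChar ψ a 0 = 1 := by
  simp [prodChar]

@[simp] theorem prodChar_zero_left (ψ : AddChar A K) (x : A × A) : prodChar ψ 0 x = 1 := by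
  simp [prodChar]

theorem prodChar_neg_left (ψ : AddChar A K) (a x : A × A) :
    prodChar ψ (-a) x = prodChar ψ a (-x) := by
  simp [prodChar]

theorem prodChar_neg_mul_self (ψ : AddChar A K) (a x : A × A) :
    prodChar ψ a (-x) * prodChar ψ a x = 1 := by
  rw [← prodChar_add_right, neg_add_cancel, prodChar_zero_right]

variable [Fintype A]

theorem sum_prodChar [DecidableEq A] {ψ : AddChar A K} (hψ : ψ.IsPrimitive) (a : A × A) :
    ∑ x, prodChar ψ a x = if a = 0 then (Fintype.card A : K) ^ 2 else 0 := by
  have hsum : ∀ a : A, ∑ s, ψ (a * s) = if a = 0 then (Fintype.card A : K) else 0 := fun a => by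
    have := AddChar.sum_mulShift a hψ
    simp only [mul_comm _ a] at this
    rw [this]
    split_ifs <;> simp
  simp only [prodChar, AddChar.map_add_eq_mul, Fintype.sum_prod_type, ← Finset.mul_sum,
    ← Finset.sum_mul, hsum, Prod.ext_iff, Prod.fst_zero, Prod.snd_zero]
  split_ifs <;> simp_all [sq]

variable {G : Type*} [Group G]

/-- The idempotent `|A|⁻² ∑ ψ(-(a₁ x₁ + a₂ x₂)) u(x)` of the group algebra of `G` attached to a
homomorphism `u` from `A × A` to `G` and to a character of `A × A`. -/
def groupIndicator (ψ : AddChar A K) (u : Multiplicative (A × A) →* G) (a : A × A) :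
    MonoidAlgebra K G :=
  ((Fintype.card A : K) ^ 2)⁻¹ •
    ∑ x, MonoidAlgebra.single (u (Multiplicative.ofAdd x)) (prodChar ψ a (-x))

theorem mapDomainAlgHom_groupIndicator {L : Type*} [Group L] (ψ : AddChar A K)
    (u : Multiplicative (A × A) →* L) (j : L →* G) (a : A × A) :
    MonoidAlgebra.mapDomainAlgHom K K j (groupIndicator ψ u a) =
      groupIndicator ψ (j.comp u) a := by
  simp [groupIndicator, MonoidAlgebra.mapDomain_single]

variable [DecidableEq A]

theorem isIndicatorFamily_groupIndicator {ψ : AddChar A K} (hψ : ψ.IsPrimitive)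
    (hA : (Fintype.card A : K) ≠ 0) (u : Multiplicative (A × A) →* G) :
    IsIndicatorFamily K (groupIndicator ψ u) := by
  set N : K := (Fintype.card A : K) ^ 2 with hN
  have hN0 : N ≠ 0 := pow_ne_zero 2 hA
  have hu : ∀ x y, u (Multiplicative.ofAdd x) * u (Multiplicative.ofAdd y) =
      u (Multiplicative.ofAdd (x + y)) := fun x y => by rw [ofAdd_add, map_mul]
  have hsum' : ∀ x, ∑ a, prodChar ψ a x = if x = 0 then N else 0 := fun x => by
    simp only [prodChar_comm ψ _ x, sum_prodChar hψ, hN]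
  constructor
  · intro a b
    have key : (∑ x, MonoidAlgebra.single (u (Multiplicative.ofAdd x)) (prodChar ψ a (-x))) *
        (∑ x, MonoidAlgebra.single (u (Multiplicative.ofAdd x)) (prodChar ψ b (-x))) =
        ∑ z, (∑ x, prodChar ψ (b - a) x) •
          MonoidAlgebra.single (u (Multiplicative.ofAdd z)) (prodChar ψ b (-z)) := by
      simp only [Finset.sum_mul_sum, MonoidAlgebra.single_mul_single, hu, Finset.sum_smul]
      rw [Finset.sum_comm' (t' := Finset.univ) (s' := fun _ => Finset.univ) (by simp)]
      rw [Finset.sum_comm]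
      conv_rhs => rw [Finset.sum_comm]
      refine Finset.sum_congr rfl fun x _ => ?_
      refine Fintype.sum_equiv (Equiv.addLeft x) _ _ fun y => ?_
      simp only [Equiv.coe_addLeft, MonoidAlgebra.smul_single, smul_eq_mul]
      congr 1
      rw [sub_eq_add_neg, prodChar_add_left, prodChar_neg_left, neg_add, prodChar_add_right,
        mul_comm (prodChar ψ b x), mul_assoc, ← mul_assoc (prodChar ψ b x),
        mul_comm (prodChar ψ b x), prodChar_neg_mul_self, one_mul]
    rw [groupIndicator, groupIndicator, smul_mul_smul_comm, key]
    simp only [sum_prodChar hψ, sub_eq_zero]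
    by_cases hab : a = b
    · subst hab
      simp only [if_true, ← Finset.smul_sum, smul_smul, ← hN]
      congr 1
      field_simp
    · simp [hab, Ne.symm hab]
  · simp only [groupIndicator, ← Finset.smul_sum]
    rw [Finset.sum_comm]
    have : ∀ x, ∑ a, MonoidAlgebra.single (u (Multiplicative.ofAdd x)) (prodChar ψ a (-x)) =
        if x = 0 then MonoidAlgebra.single (1 : G) N else 0 := by
      intro x
      have h1 := map_sum (MonoidAlgebra.lsingle (R := K) (S := K) (u (Multiplicative.ofAdd x)))
        (fun a => prodChar ψ a (-x)) Finset.univ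
      simp only [MonoidAlgebra.lsingle_apply, hsum'] at h1
      rw [← h1]
      by_cases hx : x = 0
      · simp [hx]
      · simp [hx]
    simp only [this, Finset.sum_ite_eq', Finset.mem_univ, if_true, MonoidAlgebra.smul_single,
      smul_eq_mul, ← hN, inv_mul_cancel₀ hN0, MonoidAlgebra.one_def]
  · intro a
    have h1 : ∀ (v : G) (k : K), MonoidAlgebra.single v k =
        k • MonoidAlgebra.single v (1 : K) := fun v k => by simp
    have key : ∑ b, (groupIndicator ψ u b) ⊗ₜ[K] (groupIndicator ψ u (a - b)) =
        (N⁻¹ * N⁻¹) • ∑ x, ∑ y, (prodChar ψ a (-y) * ∑ b, prodChar ψ b (y - x)) •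
          (MonoidAlgebra.single (u (Multiplicative.ofAdd x)) (1 : K) ⊗ₜ[K]
            MonoidAlgebra.single (u (Multiplicative.ofAdd y)) (1 : K)) := by
      simp only [groupIndicator, TensorProduct.smul_tmul_smul, ← Finset.smul_sum, ← hN]
      simp only [TensorProduct.sum_tmul]
      simp only [TensorProduct.tmul_sum]
      congr 1
      rw [Finset.sum_comm]
      refine Finset.sum_congr rfl fun x _ => ?_
      rw [Finset.sum_comm]
      refine Finset.sum_congr rfl fun y _ => ?_
      rw [Finset.mul_sum, Finset.sum_smul]
      refine Finset.sum_congr rfl fun b _ => ?_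
      rw [h1 _ (prodChar ψ b (-x)), h1 _ (prodChar ψ (a - b) (-y)), TensorProduct.smul_tmul_smul]
      congr 1
      rw [sub_eq_add_neg, prodChar_add_left, prodChar_neg_left, neg_neg, sub_eq_add_neg,
        prodChar_add_right]
      ring
    rw [key]
    simp only [hsum', sub_eq_zero, mul_ite, mul_zero, ite_smul, zero_smul, Finset.sum_ite_eq',
      Finset.mem_univ, if_true]
    simp only [groupIndicator, map_smul, map_sum, MonoidAlgebra.comul_single,
      CommSemiring.comul_apply, TensorProduct.map_tmul, MonoidAlgebra.lsingle_apply, ← hN]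
    rw [mul_smul]
    congr 1
    rw [Finset.smul_sum]
    refine Finset.sum_congr rfl fun x _ => ?_
    rw [smul_smul, mul_comm (prodChar ψ a (-x)), ← mul_assoc, inv_mul_cancel₀ hN0, one_mul,
      TensorProduct.smul_tmul']
    simp only [MonoidAlgebra.smul_single, smul_eq_mul, mul_one]
    rw [h1 _ (prodChar ψ a (-x)), TensorProduct.tmul_smul, TensorProduct.smul_tmul']
  · intro a
    simp only [groupIndicator, map_smul, map_sum, MonoidAlgebra.counit_single,
      CommSemiring.counit_apply, smul_eq_mul]
    have : ∑ x, prodChar ψ a (-x) = if a = 0 then N else 0 := by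
      rw [← sum_prodChar hψ a]
      exact Fintype.sum_equiv (Equiv.neg _) _ _ fun x => by simp
    rw [this]
    split_ifs <;> simp [← hN, hN0]

end GroupAlgebra

/-! ### The characters of `A × A` and the origin of the twist -/

section Characters

variable {K : Type*} [Field K] {A : Type*} [CommRing A]

/-- The duality of `A × A` with its group of characters which is defined by `ψ`. -/
def prodCharHom (ψ : AddChar A K) :
    Multiplicative (A × A) →* (Multiplicative (A × A) →* Kˣ) where
  toFun a := MonoidHom.toHomUnits
    { toFun := fun x => prodChar ψ a.toAdd x.toAdd
      map_one' := prodChar_zero_right ψ _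
      map_mul' := fun x y => prodChar_add_right ψ _ _ _ }
  map_one' := by ext x; exact prodChar_zero_left ψ _
  map_mul' a b := by ext x; exact prodChar_add_left ψ _ _ _

theorem coe_prodCharHom_apply (ψ : AddChar A K) (a x : Multiplicative (A × A)) :
    (prodCharHom ψ a x : K) = prodChar ψ a.toAdd x.toAdd :=
  rfl

variable [Fintype A]

theorem prodCharHom_bijective {ψ : AddChar A K} (hψ : ψ.IsPrimitive)
    (hA : (Fintype.card A : K) ≠ 0) : Function.Bijective (prodCharHom ψ) := by
  classical
  constructor
  · rw [injective_iff_map_eq_one]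
    intro a ha
    by_contra h0
    have h1 := sum_prodChar hψ a.toAdd
    rw [if_neg (by simpa using h0)] at h1
    have h2 : ∀ x, prodChar ψ a.toAdd x = 1 := fun x => by
      rw [← toAdd_ofAdd x, ← coe_prodCharHom_apply, ha]; rfl
    simp only [h2, Finset.sum_const, Finset.card_univ, Fintype.card_prod, nsmul_eq_mul, mul_one,
      Nat.cast_mul, mul_eq_zero, or_self] at h1
    exact hA h1
  · intro φ
    by_contra! hφ
    -- A character outside the image is orthogonal to the whole image, by translation invariance;
    -- summing the orthogonality relations isolates its value at `0`.
    have hzero : ∀ a : A × A, ∑ x : A × A,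
        (φ (Multiplicative.ofAdd x) : K) * prodChar ψ a (-x) = 0 := by
      intro a
      have hne := hφ (Multiplicative.ofAdd a)
      rw [Ne, MonoidHom.ext_iff, not_forall] at hne
      obtain ⟨y, hy⟩ := hne
      have hy' : (φ y : K) * prodChar ψ a (-y.toAdd) ≠ 1 := fun h => hy (by
        ext
        rw [coe_prodCharHom_apply, toAdd_ofAdd]
        calc prodChar ψ a y.toAdd = (φ y : K) * (prodChar ψ a (-y.toAdd) *
              prodChar ψ a y.toAdd) := by rw [← mul_assoc, h, one_mul]
          _ = φ y := by rw [prodChar_neg_mul_self, mul_one])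
      have hshift : ∑ x : A × A, (φ (Multiplicative.ofAdd x) : K) * prodChar ψ a (-x) =
          ((φ y : K) * prodChar ψ a (-y.toAdd)) *
            ∑ x : A × A, (φ (Multiplicative.ofAdd x) : K) * prodChar ψ a (-x) := by
        rw [Finset.mul_sum]
        symm
        refine Fintype.sum_equiv (Equiv.addLeft y.toAdd) _ _ fun x => ?_
        rw [Equiv.coe_addLeft, ofAdd_add, ofAdd_toAdd, map_mul, Units.val_mul, neg_add,
          prodChar_add_right]
        ring
      by_contra h0
      exact hy' (mul_right_cancel₀ h0 (by rw [one_mul, ← hshift]))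
    have h1 : ∑ a : A × A, ∑ x : A × A,
        (φ (Multiplicative.ofAdd x) : K) * prodChar ψ a (-x) = (Fintype.card A : K) ^ 2 := by
      rw [Finset.sum_comm]
      simp only [← Finset.mul_sum, prodChar_comm ψ _ (-_), sum_prodChar hψ, neg_eq_zero]
      simp
    rw [Finset.sum_eq_zero fun a _ => hzero a] at h1
    exact pow_ne_zero 2 hA h1.symm

/-- The duality of `A × A` with its group of characters, for a primitive `ψ`. -/
def prodCharEquiv {ψ : AddChar A K} (hψ : ψ.IsPrimitive) (hA : (Fintype.card A : K) ≠ 0) :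
    Multiplicative (A × A) ≃* (Multiplicative (A × A) →* Kˣ) :=
  MulEquiv.ofBijective (prodCharHom ψ) (prodCharHom_bijective hψ hA)

/-- The group algebra of a group isomorphic to `A × A` splits, since it is spanned by an indicator
family, on which the characters evaluate as the coordinates. -/
theorem groupAlgebraSplits_of_equiv {ψ : AddChar A K} (hψ : ψ.IsPrimitive)
    (hA : (Fintype.card A : K) ≠ 0) {M : Type*} [Group M] (v : Multiplicative (A × A) ≃* M) :
    GroupAlgebraSplits K M := by
  classical
  have he := isIndicatorFamily_groupIndicator hψ hA v.toMonoidHom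
  have : Finite M := Finite.of_equiv _ v.toEquiv
  have : Fintype M := Fintype.ofFinite M
  let ev : MonoidAlgebra K M →ₐ[K] (A × A → K) :=
    AlgHom.pi fun a => MonoidAlgebra.lift K K M
      ((Units.coeHom K).comp ((prodCharHom ψ (Multiplicative.ofAdd a)).comp v.symm.toMonoidHom))
  have hev : ∀ b, ev (groupIndicator ψ v.toMonoidHom b) = Pi.single b 1 := by
    intro b
    ext a
    simp only [ev, groupIndicator, map_smul, map_sum, AlgHom.pi_apply, MonoidAlgebra.lift_single,
      smul_eq_mul, MonoidHom.comp_apply]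
    have h1 : ∑ x : A × A, prodChar ψ b (-x) * prodChar ψ a x =
        if a = b then (Fintype.card A : K) ^ 2 else 0 := by
      simp only [← prodChar_neg_left, ← prodChar_add_left, sum_prodChar hψ, neg_add_eq_zero,
        eq_comm]
    have h2 : ∀ x : A × A, prodChar ψ b (-x) * (Units.coeHom K) ((prodCharHom ψ
        (Multiplicative.ofAdd a)) (v.symm.toMonoidHom (v.toMonoidHom (Multiplicative.ofAdd x)))) =
        prodChar ψ b (-x) * prodChar ψ a x := by
      intro x
      simp [coe_prodCharHom_apply]
    simp only [h2, h1, Pi.single_apply]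
    split_ifs <;> simp [hA]
  have hsurj : Function.Surjective ev := by
    intro f
    refine ⟨∑ a, f a • groupIndicator ψ v.toMonoidHom a, ?_⟩
    simp only [map_sum, map_smul, hev]
    ext b
    simp [Pi.single_apply]
  have hinj : Function.Injective ev := by
    have : FiniteDimensional K (MonoidAlgebra K M) :=
      Module.Finite.equiv (MonoidAlgebra.coeffLinearEquiv K).symm
    refine (LinearMap.injective_iff_surjective_of_finrank_eq_finrank
      (f := ev.toLinearMap) ?_).2 hsurj
    rw [(MonoidAlgebra.coeffLinearEquiv K).finrank_eq, Module.finrank_finsupp_self,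
      Module.finrank_fintype_fun_eq_card]
    exact (Fintype.card_congr (Multiplicative.ofAdd.trans v.toEquiv)).symm
  let E := Fintype.equivFin (A × A)
  exact ⟨Fintype.card (A × A), ⟨(AlgEquiv.ofBijective ev ⟨hinj, hsurj⟩).trans
    (AlgEquiv.piCongrLeft K (fun _ => K) E)⟩⟩

variable [DecidableEq A] {G : Type*} [Group G] [Finite G]

theorem arisesFromAbelianSubgroup_bicharacterTwist {ψ : AddChar A K} (hψ : ψ.IsPrimitive)
    (hA : (Fintype.card A : K) ≠ 0) (u : Multiplicative (A × A) →* G)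
    (hu : Function.Injective u) :
    ((isIndicatorFamily_groupIndicator hψ hA u).bicharacterTwist ψ).ArisesFromAbelianSubgroup := by
  let v : Multiplicative (A × A) ≃* u.range := u.ofInjective hu
  have hcard : Nat.card u.range = Fintype.card A ^ 2 := by
    rw [← Nat.card_congr v.toEquiv, sq, ← Fintype.card_prod, ← Nat.card_eq_fintype_card]
    rfl
  refine ⟨u.range, ?_, ?_, groupAlgebraSplits_of_equiv hψ hA v, ?_⟩
  · rintro _ ⟨x, rfl⟩ _ ⟨y, rfl⟩
    rw [← map_mul, mul_comm, map_mul]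
  · rw [hcard, Nat.cast_pow]
    exact pow_ne_zero 2 hA
  · let Φ : Multiplicative (A × A) ≃* (u.range →* Kˣ) :=
      (prodCharEquiv hψ hA).trans (v.monoidHomCongrLeft)
    have hΦ : ∀ a x, (Φ a (v x) : K) = prodChar ψ a.toAdd x.toAdd := by
      intro a x
      change ((prodCharHom ψ a) (v.symm (v x)) : K) = _
      rw [v.symm_apply_apply, coe_prodCharHom_apply]
    have hidem : ∀ a, charIdempotent (Φ a) = groupIndicator ψ u a.toAdd := by
      intro a
      rw [charIdempotent, groupIndicator, hcard, Nat.cast_pow]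
      congr 1
      rw [← finsum_comp_equiv v.toEquiv, ← finsum_comp_equiv Multiplicative.ofAdd,
        finsum_eq_sum_of_fintype]
      refine Finset.sum_congr rfl fun x _ => ?_
      have h1 : (((Φ a) (v (Multiplicative.ofAdd x))⁻¹ : Kˣ) : K) =
          prodChar ψ a.toAdd (-x) := by
        rw [← map_inv, hΦ]; rfl
      change MonoidAlgebra.single _ (((Φ a) (v (Multiplicative.ofAdd x))⁻¹ : Kˣ) : K) = _
      rw [h1]
      rfl
    refine ⟨fun φ χ => bicharacter ψ (Φ.symm φ).toAdd (Φ.symm χ).toAdd, ?_, ?_⟩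
    · constructor
      · intro φ χ η
        simp only [map_mul, toAdd_mul]
        exact bicharacter_cocycle ψ _ _ _
      · intro φ
        simp only [map_one, toAdd_one]
        exact bicharacter_zero_left ψ _
      · intro φ
        simp only [map_one, toAdd_one]
        exact bicharacter_zero_right ψ _
    · rw [IsIndicatorFamily.bicharacterTwist_elt, cocycleElement,
        ← finsum_comp_equiv Φ.toEquiv, ← finsum_comp_equiv Multiplicative.ofAdd,
        finsum_eq_sum_of_fintype, IsIndicatorFamily.tensorSum]
      refine Finset.sum_congr rfl fun a _ => ?_
      rw [← finsum_comp_equiv Φ.toEquiv, ← finsum_comp_equiv Multiplicative.ofAdd,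
        finsum_eq_sum_of_fintype]
      refine Finset.sum_congr rfl fun b _ => ?_
      simp only [MulEquiv.toEquiv_eq_coe, MulEquiv.symm_apply_apply, hidem,
        toAdd_ofAdd, coe_bicharacter, EquivLike.coe_coe]

end Characters

/-! ### Permutation characters -/

section Permutation

variable {K : Type*} [Field K] {L : Type*} [Group L] {Ω : Type*} [MulAction L Ω] [Fintype Ω]
  [DecidableEq Ω]

/-- The permutation representation of `L` on `Ω`, by matrices. -/
def permMatrixHom (K : Type*) [Field K] (L : Type*) [Group L] (Ω : Type*) [MulAction L Ω]
    [Fintype Ω] [DecidableEq Ω] : L →* Matrix Ω Ω K where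
  toFun l := Matrix.of fun i k => if i = l • k then 1 else 0
  map_one' := by ext i k; simp [Matrix.one_apply]
  map_mul' l l' := by
    ext i k
    simp [Matrix.mul_apply, mul_smul]

theorem trace_permMatrixHom (l : L) :
    (permMatrixHom K L Ω l).trace = (Nat.card (MulAction.fixedBy Ω l) : K) := by
  classical
  rw [Nat.card_eq_fintype_card, ← Set.toFinset_card]
  simp only [permMatrixHom, MonoidHom.coe_mk, OneHom.coe_mk, Matrix.trace, Matrix.diag_apply,
    Matrix.of_apply, Finset.sum_boole]
  congr 2
  ext i
  simp [MulAction.mem_fixedBy, eq_comm]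

end Permutation

/-- If the twist of `K G` from the subgroup `M = u(A × A)` has a Hopf order, then for every
permutation character of a subgroup `L` containing `M`, the sum of its values at the elements
`m h m' g` with `m, m' ∈ M` is divisible by `|A|²`. -/
theorem card_sq_dvd_sum_card_fixedBy {K : Type*} [Field K] [NumberField K] {A : Type*} [CommRing A]
    [Fintype A] [DecidableEq A] {ψ : AddChar A K} (hψ : ψ.IsPrimitive)
    (hA : (Fintype.card A : K) ≠ 0) {G L : Type*} [Group G] [Group L]
    (j : L →* G) (hj : Function.Injective j) (u : Multiplicative (A × A) →* L)
    {X : Submodule (NumberField.RingOfIntegers K)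
      ((isIndicatorFamily_groupIndicator hψ hA (j.comp u)).bicharacterTwist ψ).Twisted}
    (hX : IsHopfOrder K X) (g h : L) (Ω : Type*) [MulAction L Ω] [Finite Ω] :
    Fintype.card A ^ 2 ∣ ∑ x : A × A, ∑ y : A × A, Nat.card (MulAction.fixedBy Ω
      (u (Multiplicative.ofAdd x) * h * u (Multiplicative.ofAdd y) * g)) := by
  classical
  have := Fintype.ofFinite Ω
  let J : MonoidAlgebra K L →ₐ[K] MonoidAlgebra K G := MonoidAlgebra.mapDomainAlgHom K K j
  have hJ : Function.Injective J := MonoidAlgebra.mapDomain_injective hj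
  have hsingle : ∀ l : L, J (MonoidAlgebra.single l 1) = MonoidAlgebra.single (j l) 1 := fun l => by
    simp [J, MonoidAlgebra.mapDomain_single]
  have hcomul : ∀ l : L, Coalgebra.comul (R := K) (J (MonoidAlgebra.single l 1)) =
      J (MonoidAlgebra.single l 1) ⊗ₜ[K] J (MonoidAlgebra.single l 1) := fun l => by
    rw [hsingle]; simp
  have hcounit : ∀ l : L, Coalgebra.counit (R := K) (J (MonoidAlgebra.single l 1)) = 1 := fun l => by
    rw [hsingle]; simp
  obtain ⟨r, hr⟩ := IsIndicatorFamily.card_sq_mul_trace_mem J hJ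
    (isIndicatorFamily_groupIndicator hψ hA (j.comp u))
    (mapDomainAlgHom_groupIndicator ψ u j) hψ hX (hcomul g) (hcounit g) (hcomul h) (hcounit h)
    (MonoidAlgebra.lift K (Matrix Ω Ω K) L (permMatrixHom K L Ω))
  set S := ∑ x : A × A, ∑ y : A × A, Nat.card (MulAction.fixedBy Ω
      (u (Multiplicative.ofAdd x) * h * u (Multiplicative.ofAdd y) * g)) with hS
  set N : K := (Fintype.card A : K) ^ 2 with hN
  have hN0 : N ≠ 0 := pow_ne_zero 2 hA
  have hprod : groupIndicator ψ u 0 * MonoidAlgebra.single h 1 * groupIndicator ψ u 0 *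
      MonoidAlgebra.single g 1 = (N⁻¹ * N⁻¹) • ∑ x : A × A, ∑ y : A × A, MonoidAlgebra.single
      (u (Multiplicative.ofAdd x) * h * u (Multiplicative.ofAdd y) * g) (1 : K) := by
    simp only [groupIndicator, prodChar_zero_left, smul_mul_assoc, mul_smul_comm, Finset.sum_mul,
      Finset.mul_sum, MonoidAlgebra.single_mul_single, mul_one, ← Finset.smul_sum, smul_smul, ← hN]
    rw [Finset.sum_comm]
  have htrace : N * (N⁻¹ * N⁻¹ * (S : K)) = algebraMap _ K r := by
    rw [hr, hprod]
    simp only [map_smul, map_sum, MonoidAlgebra.lift_single, one_smul, Matrix.trace_smul,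
      Matrix.trace_sum, trace_permMatrixHom, smul_eq_mul, hS, Nat.cast_sum]
  -- The number `S / |A|²` is rational and integral over `R`, hence an integer.
  have hrat : algebraMap ℚ K ((S : ℚ) / (Fintype.card A : ℚ) ^ 2) = algebraMap _ K r := by
    rw [← htrace]
    simp only [map_div₀, map_natCast, map_pow, ← hN]
    field_simp
  have hint : IsIntegral ℤ ((S : ℚ) / (Fintype.card A : ℚ) ^ 2) := by
    rw [← isIntegral_algebraMap_iff (B := K) (algebraMap ℚ K).injective, hrat]
    exact NumberField.RingOfIntegers.isIntegral_coe r
  obtain ⟨z, hz⟩ := IsIntegrallyClosed.isIntegral_iff.1 hint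
  have hA' : (Fintype.card A : ℚ) ≠ 0 := by
    have : Fintype.card A ≠ 0 := fun h => hA (by simp [h])
    exact_mod_cast this
  have : (S : ℤ) = (Fintype.card A : ℤ) ^ 2 * z := by
    rw [eq_div_iff (pow_ne_zero 2 hA')] at hz
    have h2 : (S : ℚ) = (Fintype.card A : ℚ) ^ 2 * z := by
      rw [← hz, mul_comm]; rfl
    exact_mod_cast h2
  have : ((Fintype.card A ^ 2 : ℕ) : ℤ) ∣ (S : ℤ) := ⟨z, by push_cast; exact this⟩
  exact_mod_cast this

/-! ### Fixed points on a projective space -/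

/-- Fixed points on `ℙ V` are lines of eigenvectors, so they are counted by eigenvectors. -/
theorem card_fixedBy_projectivization {k V G : Type*} [Field k] [Fintype k] [DecidableEq k]
    [AddCommGroup V] [Module k V] [Fintype V] [DecidableEq V] [Group G] [DistribMulAction G V]
    [SMulCommClass G k V] (g : G) :
    Nat.card (MulAction.fixedBy (ℙ k V) g) * Fintype.card kˣ + Fintype.card kˣ =
      ∑ c : kˣ, Fintype.card {v : V // g • v = (c : k) • v} := by
  have hrep : ∀ P : MulAction.fixedBy (ℙ k V) g, ∃ c : kˣ, g • P.1.rep = (c : k) • P.1.rep := by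
    rintro ⟨P, hP⟩
    rw [MulAction.mem_fixedBy] at hP
    conv at hP => rw [← P.mk_rep, Projectivization.smul_mk]
    obtain ⟨a, ha⟩ := (Projectivization.mk_eq_mk_iff k _ _ _ _).1 hP
    exact ⟨a, ha.symm⟩
  choose c hc using hrep
  let T := {t : kˣ × V // t.2 ≠ 0 ∧ g • t.2 = (t.1 : k) • t.2}
  let F : MulAction.fixedBy (ℙ k V) g × kˣ → T := fun P =>
    ⟨(c P.1, (P.2 : k) • P.1.1.rep), smul_ne_zero P.2.ne_zero P.1.1.rep_nonzero, by
      rw [smul_comm, hc, smul_comm]⟩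
  have hF : Function.Bijective F := by
    constructor
    · rintro ⟨P, a⟩ ⟨Q, b⟩ h
      have h1 : (a : k) • P.1.rep = (b : k) • Q.1.rep := congrArg (fun t : T => t.1.2) h
      have hPQ : P = Q := by
        refine Subtype.ext ?_
        rw [← P.1.mk_rep, ← Q.1.mk_rep, Projectivization.mk_eq_mk_iff]
        refine ⟨a⁻¹ * b, ?_⟩
        rw [mul_smul, Units.smul_def b, ← h1, ← Units.smul_def, inv_smul_smul]
      subst hPQ
      have := smul_left_injective k P.1.rep_nonzero h1
      rw [Units.ext this]
    · rintro ⟨⟨d, v⟩, hv0, hv⟩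
      have hfix : Projectivization.mk k v hv0 ∈ MulAction.fixedBy (ℙ k V) g := by
        rw [MulAction.mem_fixedBy, Projectivization.smul_mk, Projectivization.mk_eq_mk_iff]
        exact ⟨d, hv.symm⟩
      let P : MulAction.fixedBy (ℙ k V) g := ⟨_, hfix⟩
      obtain ⟨a, ha⟩ := Projectivization.exists_smul_eq_mk_rep k v hv0
      have ha' : (a : k) • v = P.1.rep := ha
      have hd : c P = d := by
        refine Units.ext (smul_left_injective k P.1.rep_nonzero ?_)
        change (c P : k) • P.1.rep = (d : k) • P.1.rep
        rw [← hc, ← ha', smul_comm, hv, smul_comm]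
      refine ⟨(P, a⁻¹), Subtype.ext (Prod.ext hd ?_)⟩
      change ((a⁻¹ : kˣ) : k) • P.1.rep = v
      rw [← ha', smul_smul, Units.inv_mul, one_smul]
  have hT : Fintype.card T = ∑ c : kˣ, Fintype.card {v : V // v ≠ 0 ∧ g • v = (c : k) • v} := by
    rw [← Fintype.card_sigma]
    exact Fintype.card_congr
      { toFun := fun t => ⟨t.1.1, t.1.2, t.2⟩
        invFun := fun s => ⟨(s.1, s.2.1), s.2.2⟩
        left_inv := fun _ => rfl
        right_inv := fun _ => rfl }
  have hcard : Nat.card (MulAction.fixedBy (ℙ k V) g) * Fintype.card kˣ = Fintype.card T := by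
    rw [← Nat.card_eq_fintype_card (α := kˣ), ← Nat.card_prod, ← Nat.card_eq_fintype_card]
    exact Nat.card_congr (Equiv.ofBijective F hF)
  rw [hcard, hT, Fintype.card_eq_sum_ones (α := kˣ), ← Finset.sum_add_distrib]
  refine Finset.sum_congr rfl fun d _ => ?_
  rw [Fintype.card_subtype, Fintype.card_subtype]
  have h0 : (0 : V) ∈ Finset.univ.filter fun v : V => g • v = (d : k) • v := by simp
  rw [← Finset.card_erase_add_one h0]
  congr 2
  ext v
  simp

section Count

variable {k : Type*} [Field k] [Fintype k] [DecidableEq k]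

open Matrix

theorem card_prod_eigenvectors_of_det_ne_zero {n : Type*} [Fintype n] [DecidableEq n]
    (Y : SpecialLinearGroup n k) (c : k) (h : ((Y : Matrix n n k) - scalar n c).det ≠ 0) :
    Fintype.card {v : (n → k) × (n → k) // Y • v = c • v} = 1 := by
  have key : ∀ v : n → k, Y • v = c • v → v = 0 := fun v hv => by
    by_contra h0
    refine h (exists_mulVec_eq_zero_iff.1 ⟨v, h0, ?_⟩)
    rw [sub_mulVec, sub_eq_zero]
    refine Eq.trans hv ?_
    simp [scalar_apply, ← smul_one_eq_diagonal, smul_mulVec]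
  rw [Fintype.card_eq_one_iff]
  refine ⟨⟨0, by simp⟩, fun ⟨v, hv⟩ => Subtype.ext ?_⟩
  exact Prod.ext (key _ (congrArg Prod.fst hv)) (key _ (congrArg Prod.snd hv))

/-- The eigenspace of an eigenvalue in `kⁿ × kⁿ` is the square of the one in `kⁿ`, so its number of
elements is divisible by `|k|²`. -/
theorem card_sq_dvd_card_prod_eigenvectors {n : Type*} [Fintype n] [DecidableEq n]
    (Y : SpecialLinearGroup n k) (c : k) (h : ((Y : Matrix n n k) - scalar n c).det = 0) :
    Fintype.card k ^ 2 ∣ Fintype.card {v : (n → k) × (n → k) // Y • v = c • v} := by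
  classical
  have hiff : ∀ v : n → k, ((Y : Matrix n n k) - scalar n c) *ᵥ v = 0 ↔ Y • v = c • v := fun v => by
    rw [sub_mulVec, sub_eq_zero]
    have : scalar n c *ᵥ v = c • v := by
      simp [scalar_apply, ← smul_one_eq_diagonal, smul_mulVec]
    rw [this]
    rfl
  let E := LinearMap.ker (toLin' ((Y : Matrix n n k) - scalar n c))
  have hE : ∀ v, v ∈ E ↔ Y • v = c • v := fun v => by
    rw [LinearMap.mem_ker, toLin'_apply, hiff]
  have hcard : Fintype.card {v : (n → k) × (n → k) // Y • v = c • v} = Fintype.card E ^ 2 := by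
    rw [sq, ← Fintype.card_prod]
    exact Fintype.card_congr
      { toFun := fun v => (⟨v.1.1, (hE _).2 (congrArg Prod.fst v.2)⟩,
          ⟨v.1.2, (hE _).2 (congrArg Prod.snd v.2)⟩)
        invFun := fun w => ⟨(w.1.1, w.2.1), Prod.ext ((hE _).1 w.1.2) ((hE _).1 w.2.2)⟩
        left_inv := fun _ => rfl
        right_inv := fun _ => rfl }
  rw [hcard]
  refine pow_dvd_pow_of_dvd ?_ 2
  rw [Module.card_eq_pow_finrank (K := k) (V := E)]
  refine dvd_pow_self _ ?_
  obtain ⟨v, hv0, hv⟩ := exists_mulVec_eq_zero_iff.2 h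
  have : Nontrivial E := ⟨⟨v, by rwa [LinearMap.mem_ker, toLin'_apply]⟩, 0, fun h0 =>
    hv0 (congrArg Subtype.val h0)⟩
  exact Module.finrank_pos.ne'

end Count

/-! ### A double coset in `SL₃` -/

section DoubleCoset

variable {k : Type*} [Field k]

open Matrix

/-- The elementary abelian group of the transvections `v ↦ v + v₃ (x e₁ + y e₂)`. -/
def transvectionHom (k : Type*) [Field k] :
    Multiplicative (k × k) →* SpecialLinearGroup (Fin 3) k where
  toFun w := ⟨!![1, 0, w.toAdd.1; 0, 1, w.toAdd.2; 0, 0, 1], by simp [det_fin_three]⟩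
  map_one' := by
    ext i j; fin_cases i <;> fin_cases j <;> simp
  map_mul' w w' := by
    refine Subtype.ext ?_
    change (!![1, 0, (w * w').toAdd.1; 0, 1, (w * w').toAdd.2; 0, 0, 1] : Matrix _ _ k) =
      !![1, 0, w.toAdd.1; 0, 1, w.toAdd.2; 0, 0, 1] *
        !![1, 0, w'.toAdd.1; 0, 1, w'.toAdd.2; 0, 0, 1]
    ext i j
    fin_cases i <;> fin_cases j <;> simp [Matrix.mul_apply, Fin.sum_univ_three, add_comm]

/-- The element `h` of the double coset. -/
def cosetLeft (k : Type*) [Field k] : SpecialLinearGroup (Fin 3) k :=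
  ⟨!![0, 1, 0; 0, 1, 1; 1, 1, 0], by simp [det_fin_three]⟩

/-- The element `g`: a cyclic permutation, chosen so that `h - g⁻¹` has rank one. Therefore the
characteristic polynomials of the `m h m' g` are easy to compute. -/
def cosetRight (k : Type*) [Field k] : SpecialLinearGroup (Fin 3) k :=
  ⟨!![0, 0, 1; 1, 0, 0; 0, 1, 0], by simp [det_fin_three]⟩

/-- The element `m h m' g` of the set `M h M g`. -/
def cosetElement (w w' : k × k) : SpecialLinearGroup (Fin 3) k :=
  transvectionHom k (Multiplicative.ofAdd w) * cosetLeft k *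
    transvectionHom k (Multiplicative.ofAdd w') * cosetRight k

/-- The characteristic polynomial of `m h m' g` depends on `m` through an affine form. -/
theorem det_cosetElement_sub_scalar (w w' : k × k) (c : k) :
    ((cosetElement w w' : Matrix (Fin 3) (Fin 3) k) - scalar (Fin 3) c).det =
      c * (w'.1 - (1 - c)) * w.1 + c * (c * w'.2 - (1 - c) * w'.1) * w.2 +
        ((1 - c) ^ 3 - c * (1 - c) * w'.2) := by
  obtain ⟨x, y⟩ := w
  obtain ⟨x', y'⟩ := w'
  have h : (cosetElement (x, y) (x', y') : Matrix (Fin 3) (Fin 3) k) =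
      !![1, 0, x; 0, 1, y; 0, 0, 1] * !![0, 1, 0; 0, 1, 1; 1, 1, 0] *
        !![1, 0, x'; 0, 1, y'; 0, 0, 1] * !![0, 0, 1; 1, 0, 0; 0, 1, 0] := rfl
  rw [h, det_fin_three]
  simp [scalar_apply]
  ring

variable [Fintype k] [DecidableEq k]

theorem card_affine_eq_zero {α β : k} (γ : k) (h : α ≠ 0 ∨ β ≠ 0) :
    Fintype.card {w : k × k // α * w.1 + β * w.2 + γ = 0} = Fintype.card k := by
  rcases h with h | h
  · exact Fintype.card_congr
      { toFun := fun w => w.1.2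
        invFun := fun y => ⟨(-(β * y + γ) / α, y), by field_simp; ring⟩
        left_inv := fun ⟨⟨x, y⟩, hw⟩ => by
          have hw' : α * x + β * y + γ = 0 := hw
          refine Subtype.ext (Prod.ext ?_ rfl)
          change -(β * y + γ) / α = x
          rw [div_eq_iff h]
          linear_combination -hw'
        right_inv := fun _ => rfl }
  · exact Fintype.card_congr
      { toFun := fun w => w.1.1
        invFun := fun x => ⟨(x, -(α * x + γ) / β), by field_simp; ring⟩
        left_inv := fun ⟨⟨x, y⟩, hw⟩ => by
          have hw' : α * x + β * y + γ = 0 := hw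
          refine Subtype.ext (Prod.ext rfl ?_)
          change -(α * x + γ) / β = y
          rw [div_eq_iff h]
          linear_combination -hw'
        right_inv := fun _ => rfl }

/-- The affine form of `det_cosetElement_sub_scalar` is nonconstant for all but one `m'`, and for
this `m'` it vanishes identically. -/
theorem sum_det_cosetElement_ne_zero {c : k} (hc : c ≠ 0) :
    ∑ w' : k × k, ∑ w : k × k, (if ((cosetElement w w' : Matrix (Fin 3) (Fin 3) k) -
      scalar (Fin 3) c).det = 0 then (0 : ZMod (Fintype.card k ^ 2)) else 1) = Fintype.card k := by
  have hq : ((Fintype.card k : ZMod (Fintype.card k ^ 2))) ^ 2 = 0 := by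
    rw [← Nat.cast_pow, ZMod.natCast_self]
  have key : ∀ w' : k × k, ∑ w : k × k, (if ((cosetElement w w' : Matrix (Fin 3) (Fin 3) k) -
      scalar (Fin 3) c).det = 0 then (0 : ZMod (Fintype.card k ^ 2)) else 1) =
      if w' = (1 - c, (1 - c) ^ 2 / c) then 0 else -(Fintype.card k : ZMod _) := by
    intro w'
    split_ifs with hw'
    · refine Finset.sum_eq_zero fun w _ => if_pos ?_
      rw [det_cosetElement_sub_scalar, hw']
      field_simp
      ring
    · have hne : c * (w'.1 - (1 - c)) ≠ 0 ∨ c * (c * w'.2 - (1 - c) * w'.1) ≠ 0 := by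
        by_contra! h0
        obtain ⟨h1, h2⟩ := h0
        have h1' : w'.1 = 1 - c := sub_eq_zero.1 ((mul_eq_zero.1 h1).resolve_left hc)
        have h2' := (mul_eq_zero.1 h2).resolve_left hc
        refine hw' (Prod.ext h1' ?_)
        change w'.2 = (1 - c) ^ 2 / c
        rw [eq_div_iff hc]
        rw [h1'] at h2'
        linear_combination h2'
      have h1 := card_affine_eq_zero ((1 - c) ^ 3 - c * (1 - c) * w'.2) hne
      have h2 : ∀ x : k, (if x = 0 then (0 : ZMod (Fintype.card k ^ 2)) else 1) =
          1 - if x = 0 then 1 else 0 := fun x => by split_ifs <;> simp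
      simp only [det_cosetElement_sub_scalar, h2]
      rw [Finset.sum_sub_distrib, Finset.sum_boole, ← Fintype.card_subtype, h1, Finset.sum_const,
        Finset.card_univ, Fintype.card_prod, nsmul_eq_mul, Nat.cast_mul, ← sq, hq]
      simp
  simp only [key]
  rw [← Finset.add_sum_erase _ _ (Finset.mem_univ ((1 - c, (1 - c) ^ 2 / c) : k × k)), if_pos rfl,
    Finset.sum_congr rfl fun w' hw' => if_neg (Finset.ne_of_mem_erase hw'), Finset.sum_const,
    Finset.card_erase_of_mem (Finset.mem_univ _), Finset.card_univ, Fintype.card_prod,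
    nsmul_eq_mul, Nat.cast_sub (Nat.mul_pos Fintype.card_pos Fintype.card_pos)]
  push_cast
  linear_combination -(Fintype.card k : ZMod (Fintype.card k ^ 2)) * hq

/-- The permutation character of `SL₃` on the projective space of `k³ × k³` violates the
divisibility condition for Hopf orders. -/
theorem not_card_sq_dvd_sum_card_fixedBy :
    ¬ Fintype.card k ^ 2 ∣ ∑ w : k × k, ∑ w' : k × k,
      Nat.card (MulAction.fixedBy (ℙ k ((Fin 3 → k) × (Fin 3 → k))) (cosetElement w w')) := by
  intro hdvd
  have hq : ((Fintype.card k : ZMod (Fintype.card k ^ 2))) ^ 2 = 0 := by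
    rw [← Nat.cast_pow, ZMod.natCast_self]
  have hS := (ZMod.natCast_eq_zero_iff _ _).2 hdvd
  have hD : ∀ (w w' : k × k) (c : kˣ), ((Fintype.card {v : (Fin 3 → k) × (Fin 3 → k) //
      cosetElement w w' • v = (c : k) • v} : ℕ) : ZMod (Fintype.card k ^ 2)) =
      if ((cosetElement w w' : Matrix (Fin 3) (Fin 3) k) - scalar (Fin 3) (c : k)).det = 0
        then 0 else 1 := by
    intro w w' c
    split_ifs with h
    · exact (ZMod.natCast_eq_zero_iff _ _).2 (card_sq_dvd_card_prod_eigenvectors _ _ h)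
    · rw [card_prod_eigenvectors_of_det_ne_zero _ _ h, Nat.cast_one]
  have key : ∀ w w' : k × k, ((Nat.card (MulAction.fixedBy (ℙ k ((Fin 3 → k) × (Fin 3 → k)))
      (cosetElement w w')) : ℕ) : ZMod (Fintype.card k ^ 2)) * (Fintype.card kˣ : ℕ) =
      (∑ c : kˣ, if ((cosetElement w w' : Matrix (Fin 3) (Fin 3) k) -
        scalar (Fin 3) (c : k)).det = 0 then 0 else 1) - (Fintype.card kˣ : ℕ) := by
    intro w w'
    have := congrArg (Nat.cast (R := ZMod (Fintype.card k ^ 2)))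
      (card_fixedBy_projectivization (k := k) (V := (Fin 3 → k) × (Fin 3 → k))
        (cosetElement w w'))
    push_cast at this
    simp only [hD] at this
    rw [eq_sub_iff_add_eq]
    exact_mod_cast this
  -- Modulo `|k|²`, every `c` contributes `|k|` to the sum of the fixed points times `|kˣ|`.
  have htotal : (Fintype.card kˣ : ZMod (Fintype.card k ^ 2)) * Fintype.card k = 0 := by
    have h1 : ∑ w : k × k, ∑ w' : k × k, ((Nat.card (MulAction.fixedBy
        (ℙ k ((Fin 3 → k) × (Fin 3 → k))) (cosetElement w w')) : ℕ) :
        ZMod (Fintype.card k ^ 2)) * (Fintype.card kˣ : ℕ) = 0 := by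
      simp only [← Finset.sum_mul]
      rw [← zero_mul ((Fintype.card kˣ : ℕ) : ZMod (Fintype.card k ^ 2)), ← hS]
      push_cast
      rfl
    simp only [key, Finset.sum_sub_distrib] at h1
    have h2 : ∑ w : k × k, ∑ w' : k × k, ∑ c : kˣ, (if ((cosetElement w w' :
        Matrix (Fin 3) (Fin 3) k) - scalar (Fin 3) (c : k)).det = 0 then
        (0 : ZMod (Fintype.card k ^ 2)) else 1) = (Fintype.card kˣ : ℕ) * (Fintype.card k : ℕ) := by
      rw [Finset.sum_comm]
      rw [Finset.sum_congr rfl fun w' _ => Finset.sum_comm, Finset.sum_comm]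
      rw [Finset.sum_congr rfl fun (c : kˣ) _ => sum_det_cosetElement_ne_zero c.ne_zero]
      rw [Finset.sum_const, Finset.card_univ, nsmul_eq_mul]
    rw [h2] at h1
    simp only [Finset.sum_const, Finset.card_univ, Fintype.card_prod, nsmul_eq_mul,
      Nat.cast_mul] at h1
    linear_combination h1 + (Fintype.card k : ZMod (Fintype.card k ^ 2)) ^ 2 *
      (Fintype.card kˣ : ZMod (Fintype.card k ^ 2)) * hq
  have h1 : 1 < Fintype.card k := Fintype.one_lt_card
  have hunits : (Fintype.card kˣ : ZMod (Fintype.card k ^ 2)) = Fintype.card k - 1 := by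
    rw [Fintype.card_units, Nat.cast_sub h1.le, Nat.cast_one]
  rw [hunits, sub_mul, ← sq, hq, one_mul, zero_sub, neg_eq_zero, ZMod.natCast_eq_zero_iff] at htotal
  have := Nat.le_of_dvd (by omega) htotal
  nlinarith

end DoubleCoset

/-! ### Embedding into a projective special linear group -/

section Embedding

open Matrix

/-- The embedding `A ↦ diag(A, 1)` of special linear groups. -/
def blockHom (R : Type*) [CommRing R] {ι κ ν : Type*} [Fintype ι] [DecidableEq ι] [Fintype κ]
    [DecidableEq κ] [Fintype ν] [DecidableEq ν] (e : ι ⊕ κ ≃ ν) :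
    SpecialLinearGroup ι R →* SpecialLinearGroup ν R where
  toFun A := ⟨reindex e e (fromBlocks A 0 0 1), by simp⟩
  map_one' := Subtype.ext (by simp [fromBlocks_one])
  map_mul' A B := Subtype.ext (by
    change reindex e e (fromBlocks ((A : Matrix ι ι R) * (B : Matrix ι ι R)) 0 0 1) =
      reindex e e (fromBlocks (A : Matrix ι ι R) 0 0 1) *
        reindex e e (fromBlocks (B : Matrix ι ι R) 0 0 1)
    simp [fromBlocks_multiply, submatrix_mul_equiv])

/-- The homomorphism `A ↦ diag(A, 1)` from `SL₃(k)` to `PSL_N(F)`, for `N ≥ 3` and a field extension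
`F` of `k`. -/
def toProjectiveHom {k F : Type*} [Field k] [Field F] (f : k →+* F) {N t : ℕ}
    (e : Fin 3 ⊕ Fin t ≃ Fin N) :
    SpecialLinearGroup (Fin 3) k →* ProjectiveSpecialLinearGroup (Fin N) F :=
  (QuotientGroup.mk' _).comp ((blockHom F e).comp (SpecialLinearGroup.map f))

/-- Only scalar matrices become trivial in `PSL_N(F)`. For `N = 3` there may be nontrivial ones. -/
theorem eq_scalar_of_toProjectiveHom_eq_one {k F : Type*} [Field k] [Field F] (f : k →+* F)
    {N t : ℕ} (e : Fin 3 ⊕ Fin t ≃ Fin N) {A : SpecialLinearGroup (Fin 3) k}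
    (hA : toProjectiveHom f e A = 1) :
    (A : Matrix (Fin 3) (Fin 3) k) = scalar (Fin 3) ((A : Matrix (Fin 3) (Fin 3) k) 0 0) := by
  have h1 := (QuotientGroup.eq_one_iff _).1 hA
  obtain ⟨r, -, hr⟩ := Matrix.SpecialLinearGroup.mem_center_iff.1 h1
  have hentry : ∀ i j, f ((A : Matrix (Fin 3) (Fin 3) k) i j) = if i = j then r else 0 := by
    intro i j
    have h2 := congrFun (congrFun hr (e (Sum.inl i))) (e (Sum.inl j))
    have h3 : (blockHom F e (SpecialLinearGroup.map f A) : Matrix (Fin N) (Fin N) F)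
        (e (Sum.inl i)) (e (Sum.inl j)) = f ((A : Matrix (Fin 3) (Fin 3) k) i j) := by
      change reindex e e (fromBlocks ((A : Matrix (Fin 3) (Fin 3) k).map f) 0 0 1)
        (e (Sum.inl i)) (e (Sum.inl j)) = _
      simp
    refine h3.symm.trans (h2.symm.trans ?_)
    simp [scalar_apply, diagonal_apply]
  ext i j
  apply f.injective
  rw [hentry i j]
  by_cases hij : i = j
  · subst hij
    simp [scalar_apply, hentry]
  · simp [scalar_apply, hij]

end Embedding

open Matrix in
/-- A finite group which contains a quotient of `SL₃(k)` by scalar matrices has a twist without Hopf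
orders. The scalar matrices act trivially on the projective space of `k³ × k³`, so its permutation
character is one of the image of `SL₃(k)`. -/
theorem exists_twist_without_hopfOrder {K : Type*} [Field K] [NumberField K] {k : Type*} [Field k]
    [Fintype k] [DecidableEq k] {ψ : AddChar k K} (hψ : ψ.IsPrimitive) {G : Type*} [Group G]
    [Finite G] (π : SpecialLinearGroup (Fin 3) k →* G)
    (hπ : ∀ A, π A = 1 → (A : Matrix (Fin 3) (Fin 3) k) =
      scalar (Fin 3) ((A : Matrix (Fin 3) (Fin 3) k) 0 0)) :
    ∃ J : DrinfeldTwist K (MonoidAlgebra K G), J.ArisesFromAbelianSubgroup ∧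
      ¬ ∃ X : Submodule (NumberField.RingOfIntegers K) J.Twisted, IsHopfOrder K X := by
  have hcard : (Fintype.card k : K) ≠ 0 := by
    exact_mod_cast Fintype.card_ne_zero
  let L := SpecialLinearGroup (Fin 3) k ⧸ π.ker
  let mk : SpecialLinearGroup (Fin 3) k →* L := QuotientGroup.mk' π.ker
  let j : L →* G := QuotientGroup.kerLift π
  have hj : Function.Injective j := QuotientGroup.kerLift_injective π
  let u : Multiplicative (k × k) →* L := mk.comp (transvectionHom k)
  have hu : Function.Injective (j.comp u) := by
    rw [injective_iff_map_eq_one]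
    intro w hw
    have h1 : (transvectionHom k w : Matrix (Fin 3) (Fin 3) k) = _ := hπ _ hw
    have h2 := congrFun (congrFun h1 0) 2
    have h3 := congrFun (congrFun h1 1) 2
    simp [transvectionHom, scalar_apply] at h2 h3
    exact Prod.ext h2 h3
  refine ⟨(isIndicatorFamily_groupIndicator hψ hcard (j.comp u)).bicharacterTwist ψ,
    arisesFromAbelianSubgroup_bicharacterTwist hψ hcard _ hu, ?_⟩
  rintro ⟨X, hX⟩
  let Ω := ℙ k ((Fin 3 → k) × (Fin 3 → k))
  let act : L →* Equiv.Perm Ω := QuotientGroup.lift π.ker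
    (MulAction.toPermHom (SpecialLinearGroup (Fin 3) k) Ω) (by
      intro A hA
      have hA' := hπ A hA
      have hsmul : ∀ v : Fin 3 → k, A • v = (A : Matrix (Fin 3) (Fin 3) k) 0 0 • v := by
        intro v
        change (A : Matrix (Fin 3) (Fin 3) k) *ᵥ v = _
        conv_lhs => rw [hA']
        simp [scalar_apply, ← smul_one_eq_diagonal, smul_mulVec]
      have hne : (A : Matrix (Fin 3) (Fin 3) k) 0 0 ≠ 0 := by
        intro h0
        have := A.det_coe
        rw [hA', h0] at this
        simp at this
      refine Equiv.ext fun P => ?_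
      induction P using Projectivization.ind with
      | h v hv =>
        change A • Projectivization.mk k v hv = Projectivization.mk k v hv
        rw [Projectivization.smul_mk, Projectivization.mk_eq_mk_iff]
        exact ⟨Units.mk0 _ hne, (Prod.ext (hsmul v.1) (hsmul v.2)).symm⟩)
  let _ : MulAction L Ω := MulAction.compHom Ω act
  refine not_card_sq_dvd_sum_card_fixedBy (k := k) ?_
  exact card_sq_dvd_sum_card_fixedBy hψ hcard j hj u hX (mk (cosetRight k)) (mk (cosetLeft k)) Ω

end

theorem mainTheorem3 (K : Type*) [Field K] [NumberField K]
    (p m n : ℕ) (hp : p.Prime) (hm : 1 ≤ m) (hn : 1 ≤ n)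
    (F : Type*) [Field F] [Finite F] (hF : Nat.card F = p ^ m)
    (ζ : K) (hζ : IsPrimitiveRoot ζ p) :
    ∃ J : DrinfeldTwist K
        (MonoidAlgebra K (Matrix.ProjectiveSpecialLinearGroup (Fin (2 * n + 1)) F)),
      J.ArisesFromAbelianSubgroup ∧
        ¬ ∃ X : Submodule (NumberField.RingOfIntegers K) J.Twisted, IsHopfOrder K X := by
  have : Fact p.Prime := ⟨hp⟩
  have : NeZero p := ⟨hp.ne_zero⟩
  have : Fintype F := Fintype.ofFinite F
  have : CharP F p := charP_of_card_eq_prime_pow (Nat.card_eq_fintype_card.symm.trans hF)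
  have : Finite (Matrix.SpecialLinearGroup (Fin (2 * n + 1)) F) := Subtype.finite
  have e : Fin 3 ⊕ Fin (2 * n - 2) ≃ Fin (2 * n + 1) :=
    finSumFinEquiv.trans (finCongr (by omega))
  exact exists_twist_without_hopfOrder (AddChar.zmodChar_primitive_of_primitive_root p hζ)
    (toProjectiveHom (ZMod.castHom dvd_rfl F) e)
    fun A hA => eq_scalar_of_toProjectiveHom_eq_one _ e hA
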